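/- **Definitions.** For a subset $E$ of $\mathbb{R}^n$ and $r>0$ let $N_r(E)$ be the least number of sets of diameter at most $r$ that can cover $E$ ($\infty$ if there is no finite cover). The lower and upper box dimensions of $E$ are $$\underline{\dim}_{\mathrm B} E=\liminf_{r\to0}\frac{\log N_r(E)}{-\log r},\qquad \overline{\dim}_{\mathrm B} E=\limsup_{r\to0}\frac{\log N_r(E)}{-\log r},$$ and the packing dimension of $E$ is $$\dim_{\mathrm P} E=\inf\Big\{\sup_j\overline{\dim}_{\mathrm B}E_j : E\subseteq\bigcup_{j=1}^\infty E_j \text{ with } E_j \text{ compact}\Big\}.$$ The Assouad dimension of $E$ is $$\dim_{\mathrm A}E=\inf\Big\{\alpha : \exists\, C>0\ \ \forall\, 0<r<R\ \ \forall x\in E,\ N_r(B(x,R)\cap E)\le C\,(R/r)^\alpha\Big\},$$ and, for $\theta\in(0,1)$, its upper Assouad spectrum is $$\overline{\dim}_{\mathrm A}^{\theta}E=\inf\Big\{\alpha : \exists\, C>0\ \ \forall\, 0<r\le R^{1/\theta}<R<1\ \ \forall x\in E,\ N_r(B(x,R)\cap E)\le C\,(R/r)^\alpha\Big\}.$$ Let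 $G(n,m)$ be the Grassmannian of $m$-dimensional linear subspaces of $\mathbb{R}^n$ with its natural $O(n)$-invariant probability measure, and for $V\in G(n,m)$ let $\pi_V$ be orthogonal projection onto $V$. **Theorem.** Let $1\le m<n$ be integers, $\theta\in(0,1)$ and let $F\subseteq\mathbb{R}^n$ be non-empty. If $F$ is bounded then, for almost all $V\in G(n,m)$, $$\overline{\dim}_{\mathrm B}\,\pi_V F\ \ge\ \overline{\dim}_{\mathrm B} F-\max\big\{0,\ \overline{\dim}_{\mathrm A}^{\theta}F-m,\ (\dim_{\mathrm A}F-m)(1-\theta)\big\},$$ and, for almost all $V\in G(n,m)$, $$\underline{\dim}_{\mathrm B}\,\pi_V F\ \ge\ \underline{\dim}_{\mathrm B} F-\max\big\{0,\ \overline{\dim}_{\mathrm A}^{\theta}F-m,\ (\dim_{\mathrm A}F-m)(1-\theta)\big\}.$$ If $F$ is a Borel set (bounded or not) then, for almost all $V\in G(n,m)$, $$\dim_{\mathrm P}\pi_V F\ \ge\ \dim_{\mathrm P} F-\max\big\{0,\ \overline{\dim}_{\mathrm A}^{\theta}F-m,\ (\dim_{\mathrm A}F-m)(1-\theta)\big\}.$$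 -/

import Mathlib

open Filter Topology MeasureTheory Set

namespace ProjDim

noncomputable section

/-! ### Covering numbers and dimensions of sets -/

section Dimensions

variable {X : Type*} [MetricSpace X]

/-- `coveringNumber r F` is the least number of sets of diameter at most `r` that can cover `F`
(it is `⊤` if there is no finite cover). -/
def coveringNumber (r : ℝ) (F : Set X) : ℕ∞ :=
  ⨅ (𝒰 : Set (Set X)) (_ : (∀ U ∈ 𝒰, Metric.ediam U ≤ ENNReal.ofReal r) ∧ F ⊆ ⋃₀ 𝒰), 𝒰.encard

/-- The quotient `log N_r(F) / (- log r)`, as an extended real number. -/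
def boxRatio (F : Set X) (r : ℝ) : EReal :=
  ENNReal.log (coveringNumber r F : ENNReal) / ((-Real.log r : ℝ) : EReal)

/-- The upper box-counting dimension. -/
def upperBoxDim (F : Set X) : EReal :=
  limsup (boxRatio F) (𝓝[>] (0 : ℝ))

/-- The lower box-counting dimension. -/
def lowerBoxDim (F : Set X) : EReal :=
  liminf (boxRatio F) (𝓝[>] (0 : ℝ))

/-- The packing dimension: the infimum of `sup_j upperBoxDim (A j)` over all countable covers of `F`
by compact sets `A j`. -/
def packingDim (F : Set X) : EReal :=
  ⨅ (A : ℕ → Set X) (_ : (∀ j, IsCompact (A j)) ∧ F ⊆ ⋃ j, A j), ⨆ j, upperBoxDim (A j)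

/-- The Assouad dimension. -/
def assouadDim (F : Set X) : EReal :=
  ⨅ (α : ℝ) (_ : ∃ C : ℝ, 0 < C ∧ ∀ r R : ℝ, 0 < r → r < R → ∀ x ∈ F,
    (coveringNumber r (Metric.closedBall x R ∩ F) : ENNReal) ≤ ENNReal.ofReal (C * (R / r) ^ α)),
    (α : EReal)

/-- The upper Assouad spectrum at `θ`. -/
def upperAssouadSpectrum (θ : ℝ) (F : Set X) : EReal :=
  ⨅ (α : ℝ) (_ : ∃ C : ℝ, 0 < C ∧
    ∀ r R : ℝ, 0 < r → 0 < R → R < 1 → r ≤ R ^ (1 / θ) → ∀ x ∈ F,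
    (coveringNumber r (Metric.closedBall x R ∩ F) : ENNReal) ≤ ENNReal.ofReal (C * (R / r) ^ α)),
    (α : EReal)

end Dimensions

/-! ### The Grassmannian and its invariant measure -/

/-- Euclidean `n`-space. -/
abbrev Euc (n : ℕ) : Type := EuclideanSpace ℝ (Fin n)

/-- The Grassmannian `G(n, m)` of `m`-dimensional linear subspaces of `ℝⁿ`. -/
def Grassmannian (n m : ℕ) : Type :=
  {V : Submodule ℝ (Euc n) // Module.finrank ℝ V = m}

/-- Orthogonal projection onto `V`, as an operator on `ℝⁿ`. -/
def Grassmannian.proj {n m : ℕ} (V : Grassmannian n m) : Euc n →L[ℝ] Euc n :=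
  V.1.starProjection

/-- `G(n, m)` carries the topology given by the metric `‖π_V - π_W‖` (operator norm). -/
instance (n m : ℕ) : TopologicalSpace (Grassmannian n m) :=
  TopologicalSpace.induced Grassmannian.proj inferInstance

instance (n m : ℕ) : MeasurableSpace (Grassmannian n m) := borel _

instance (n m : ℕ) : BorelSpace (Grassmannian n m) := ⟨rfl⟩

instance (n : ℕ) : ContinuousStar (Euc n →L[ℝ] Euc n) :=
  ⟨(ContinuousLinearMap.adjoint : (Euc n →L[ℝ] Euc n) ≃ₗᵢ⋆[ℝ] (Euc n →L[ℝ] Euc n)).continuous⟩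

/-- The orthogonal group `O(n)`, as the group of linear operators `g` on `ℝⁿ` with
`g* g = g g* = 1`, with the operator norm topology and the Borel σ-algebra. -/
abbrev OrthGroup (n : ℕ) := unitary (Euc n →L[ℝ] Euc n)

instance (n : ℕ) : CompactSpace (OrthGroup n) := by
  have : ProperSpace (Euc n →L[ℝ] Euc n) := FiniteDimensional.proper ℝ _
  refine isCompact_iff_compactSpace.mp
    (Metric.isCompact_of_isClosed_isBounded isClosed_unitary ?_)
  refine isBounded_iff_forall_norm_le.mpr ⟨1, fun u hu => ?_⟩
  refine ContinuousLinearMap.opNorm_le_bound _ zero_le_one fun x => ?_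
  simpa using (Unitary.norm_map ⟨u, hu⟩ x).le

/-- The Haar probability measure on `O(n)`. -/
def orthHaar (n : ℕ) : Measure (OrthGroup n) :=
  Measure.haarMeasure ⊤

instance (n : ℕ) : IsProbabilityMeasure (orthHaar n) :=
  ⟨by simpa [orthHaar] using Measure.haarMeasure_self (K₀ := (⊤ : TopologicalSpace.PositiveCompacts
    (OrthGroup n)))⟩

/-- The action of `O(n)` on `G(n, m)`: `g` sends `V` to its image `g V`. -/
def Grassmannian.rotate {n m : ℕ} (g : OrthGroup n) (V : Grassmannian n m) : Grassmannian n m :=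
  ⟨V.1.map (Unitary.linearIsometryEquiv g).toLinearEquiv.toLinearMap,
    (LinearEquiv.finrank_map_eq _ V.1).trans V.2⟩

/-- The base point of `G(n, m)`: the span of the first `m` standard basis vectors. -/
def Grassmannian.base {n m : ℕ} (h : m ≤ n) : Grassmannian n m :=
  ⟨Submodule.span ℝ
    (Set.range fun i : Fin m => (EuclideanSpace.single (Fin.castLE h i) (1 : ℝ) : Euc n)), by
    have hli : LinearIndependent ℝ
        (fun i : Fin m => (EuclideanSpace.single (Fin.castLE h i) (1 : ℝ) : Euc n)) := by
      have := (EuclideanSpace.basisFun (Fin n) ℝ).orthonormal.linearIndependent.comp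
        (Fin.castLE h) (Fin.castLE_injective h)
      simpa [Function.comp_def] using this
    simpa using finrank_span_eq_card hli⟩

theorem Grassmannian.proj_rotate {n m : ℕ} (g : OrthGroup n) (V : Grassmannian n m) :
    (V.rotate g).proj = (g : Euc n →L[ℝ] Euc n) * V.proj * (star g : OrthGroup n) := by
  ext1 x
  have := Submodule.starProjection_map_apply (Unitary.linearIsometryEquiv g) V.1 x
  exact this

theorem Grassmannian.continuous_rotate {n m : ℕ} (V : Grassmannian n m) :
    Continuous fun g : OrthGroup n => V.rotate g := by
  refine continuous_induced_rng.mpr ?_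
  have : (Grassmannian.proj ∘ fun g : OrthGroup n => V.rotate g) = fun g : OrthGroup n =>
      (g : Euc n →L[ℝ] Euc n) * V.proj * (star g : OrthGroup n) :=
    funext fun g => Grassmannian.proj_rotate g V
  rw [this]
  fun_prop

/-- The natural invariant measure on `G(n, m)`: the image of the Haar probability measure on `O(n)`
under `g ↦ g V₀`, where `V₀` is the base point. -/
def grassmannMeasure {n m : ℕ} (h : m ≤ n) : Measure (Grassmannian n m) :=
  (orthHaar n).map fun g => (Grassmannian.base h).rotate g

instance {n m : ℕ} (h : m ≤ n) : IsProbabilityMeasure (grassmannMeasure h) :=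
  Measure.isProbabilityMeasure_map (Grassmannian.base h).continuous_rotate.measurable.aemeasurable

end

end ProjDim

open ProjDim

/-!
For `δ = 2⁻ᵏ` take a `δ`-net `P` of `F`. By Cauchy–Schwarz, `|P|²` is at most `N_δ(π_V P)` times
the number of pairs of points of `P` that `π_V` maps `δ`-close together. Since `π_V` shrinks a
vector of length `R` to length `δ` with probability at most `c (δ / R)ᵐ`, the expected number of
pairs at distance about `R` is controlled by the number of points of `P` in balls of radius `R`.
The Assouad dimension bounds that number when `R ≤ δ^θ` and the Assouad spectrum bounds it when
`R ≥ δ^θ`, so the expected number of close pairs is at most `δ^(-D) |P|` up to arbitrarily small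
powers of `δ`, where `D` is the maximum in the theorem. Markov's inequality and Borel–Cantelli
give the almost sure estimate at all small scales, and with it both box dimensions.

For packing dimension, write `F` as a continuous image of a Polish space and discard the points
with a neighbourhood whose image has packing dimension at most `s < dim_P F`. In the rest every
basic open set has an image of upper box dimension greater than `s`, so that the box dimension
bound applies to countably many sets, and Baire's theorem passes from these to all compact covers
of `π_V F`.
-/

namespace ProjDim

open scoped Finset

/-! ### Transversal families of maps -/

/-- Transversality, in the sense of Peres and Schlag, of a family of maps `π ω : X → Y` indexed by a
measure space: the probability that `π ω` brings `x` and `y` to within `ρ` of each other is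
at most a constant times `(ρ / dist x y) ^ m`. The orthogonal projections onto `m`-dimensional
subspaces are the model case, and `m` is the dimension of the target in general. -/
structure IsTransversal {Ω X Y : Type*} [MeasurableSpace Ω] [MetricSpace X] [MetricSpace Y]
    (μ : Measure Ω) (π : Ω → X → Y) (m : ℝ) : Prop where
  measurable_dist : ∀ x y, Measurable fun ω => dist (π ω x) (π ω y)
  exists_measure_dist_le : ∃ c : ℝ, 0 < c ∧ ∀ ρ : ℝ, 0 < ρ → ∀ x y : X, x ≠ y →
    μ {ω | dist (π ω x) (π ω y) ≤ ρ} ≤ ENNReal.ofReal (c * (ρ / dist x y) ^ m)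

section Slab

variable {E : Type*} [NormedAddCommGroup E] [InnerProductSpace ℝ E] [FiniteDimensional ℝ E]
  [MeasurableSpace E] [BorelSpace E]

theorem volume_closedBall_zero_eq (r : ℝ) :
    volume (Metric.closedBall (0 : E) r) =
      volume (Metric.closedBall (0 : Euc (Module.finrank ℝ E)) r) := by
  rw [← (stdOrthonormalBasis ℝ E).measurePreserving_repr.measure_preimage
    Metric.isClosed_closedBall.nullMeasurableSet]
  simp [LinearIsometryEquiv.preimage_closedBall]

theorem volume_slab_le (V : Submodule ℝ E) {ρ : ℝ} (hρ : 0 ≤ ρ) :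
    volume {x : E | ‖x‖ ≤ 1 ∧ ‖V.starProjection x‖ ≤ ρ} ≤
      ENNReal.ofReal (ρ ^ Module.finrank ℝ V) *
        (volume (Metric.ball (0 : Euc (Module.finrank ℝ V)) 1) *
          volume (Metric.closedBall (0 : Euc (Module.finrank ℝ Vᗮ)) 1)) := by
  have hprod : MeasurePreserving
      (fun x : E => WithLp.ofLp (V.orthogonalDecomposition x)) volume (volume.prod volume) :=
    (WithLp.volume_preserving_ofLp V Vᗮ).comp V.orthogonalDecomposition.measurePreserving
  have hsub : {x : E | ‖x‖ ≤ 1 ∧ ‖V.starProjection x‖ ≤ ρ} ⊆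
      (fun x : E => WithLp.ofLp (V.orthogonalDecomposition x)) ⁻¹'
        (Metric.closedBall 0 ρ ×ˢ Metric.closedBall 0 1) := fun x ⟨hx, hVx⟩ => by
    refine ⟨mem_closedBall_zero_iff.mpr ?_, mem_closedBall_zero_iff.mpr ?_⟩
    · simpa using hVx
    · simpa using (Vᗮ.norm_orthogonalProjectionOnto_apply_le x).trans hx
  refine (measure_mono hsub).trans_eq ?_
  rw [hprod.measure_preimage
    (Metric.isClosed_closedBall.prod Metric.isClosed_closedBall).nullMeasurableSet,
    Measure.prod_prod, volume_closedBall_zero_eq (E := V), volume_closedBall_zero_eq (E := Vᗮ),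
    Measure.addHaar_closedBall _ _ hρ, finrank_euclideanSpace_fin, mul_assoc]

end Slab

section Grassmannian

variable {n m : ℕ}

theorem exists_orthGroup_apply_eq {x y : Euc n} (h : ‖x‖ = ‖y‖) :
    ∃ g : OrthGroup n, (g : Euc n →L[ℝ] Euc n) x = y :=
  ⟨Unitary.linearIsometryEquiv.symm ((ℝ ∙ (x - y))ᗮ.reflection), by
    simpa using Submodule.reflection_sub h⟩

theorem Grassmannian.continuous_proj :
    Continuous (Grassmannian.proj : Grassmannian n m → Euc n →L[ℝ] Euc n) :=
  continuous_induced_dom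

theorem Grassmannian.continuous_norm_proj :
    Continuous fun p : Grassmannian n m × Euc n => ‖p.1.proj p.2‖ :=
  ((Grassmannian.continuous_proj.comp continuous_fst).clm_apply continuous_snd).norm

theorem Grassmannian.measurableSet_norm_proj_le (x : Euc n) (ρ : ℝ) :
    MeasurableSet {V : Grassmannian n m | ‖V.proj x‖ ≤ ρ} :=
  (isClosed_le (Grassmannian.continuous_norm_proj.comp (by fun_prop :
    Continuous fun V : Grassmannian n m => (V, x))) continuous_const).measurableSet

theorem Grassmannian.norm_proj_rotate_apply (g : OrthGroup n) (V : Grassmannian n m) (x : Euc n) :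
    ‖(V.rotate g).proj ((g : Euc n →L[ℝ] Euc n) x)‖ = ‖V.proj x‖ := by
  have hx : ((star g : OrthGroup n) : Euc n →L[ℝ] Euc n) ((g : Euc n →L[ℝ] Euc n) x) = x :=
    DFunLike.congr_fun (Unitary.coe_star_mul_self g) x
  rw [Grassmannian.proj_rotate, mul_apply_eq_comp, mul_apply_eq_comp, hx]
  exact Unitary.norm_map g _

theorem Grassmannian.rotate_mul (g k : OrthGroup n) (V : Grassmannian n m) :
    V.rotate (g * k) = (V.rotate k).rotate g := by
  refine Subtype.ext ((Submodule.map_comp _ _ _).symm.trans ?_).symm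
  rfl

theorem Grassmannian.continuous_rotate_left (g : OrthGroup n) :
    Continuous fun V : Grassmannian n m => V.rotate g := by
  refine continuous_induced_rng.mpr ?_
  simp only [Function.comp_def, Grassmannian.proj_rotate]
  exact (continuous_const.mul Grassmannian.continuous_proj).mul continuous_const

instance : (orthHaar n).IsMulLeftInvariant := by
  unfold orthHaar; infer_instance

theorem measurePreserving_rotate (h : m ≤ n) (g : OrthGroup n) :
    MeasurePreserving (Grassmannian.rotate g) (grassmannMeasure h) (grassmannMeasure h) := by
  have hmeas := (Grassmannian.continuous_rotate_left (m := m) g).measurable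
  have hbase := (Grassmannian.base h).continuous_rotate.measurable
  refine ⟨hmeas, ?_⟩
  conv_rhs => rw [grassmannMeasure, ← map_mul_left_eq_self (orthHaar n) g,
    Measure.map_map hbase (measurable_const_mul g)]
  rw [grassmannMeasure, Measure.map_map hmeas hbase]
  simp only [Function.comp_def, Grassmannian.rotate_mul]

theorem grassmannMeasure_norm_proj_le_congr (h : m ≤ n) (ρ : ℝ) {x y : Euc n} (hxy : ‖x‖ = ‖y‖) :
    grassmannMeasure h {V | ‖V.proj x‖ ≤ ρ} = grassmannMeasure h {V | ‖V.proj y‖ ≤ ρ} := by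
  obtain ⟨g, rfl⟩ := exists_orthGroup_apply_eq hxy
  have hg := (measurePreserving_rotate h g).measure_preimage
    (Grassmannian.measurableSet_norm_proj_le ((g : Euc n →L[ℝ] Euc n) x) ρ).nullMeasurableSet
  simpa only [preimage_ofPred_eq, Grassmannian.norm_proj_rotate_apply] using hg

theorem grassmannMeasure_norm_proj_le_anti (h : m ≤ n) (ρ : ℝ) {x y : Euc n} (hxy : ‖x‖ ≤ ‖y‖) :
    grassmannMeasure h {V | ‖V.proj y‖ ≤ ρ} ≤ grassmannMeasure h {V | ‖V.proj x‖ ≤ ρ} := by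
  set t : ℝ := ‖x‖ / ‖y‖
  have ht : ‖t • y‖ = ‖x‖ := by
    rw [norm_smul, Real.norm_of_nonneg (by positivity)]
    exact div_mul_cancel_of_imp fun hy => le_antisymm (hxy.trans_eq hy) (norm_nonneg x)
  rw [← grassmannMeasure_norm_proj_le_congr h ρ ht]
  refine measure_mono fun V (hV : ‖V.proj y‖ ≤ ρ) => le_trans ?_ hV
  rw [map_smul, norm_smul, Real.norm_of_nonneg (by positivity)]
  exact mul_le_of_le_one_left (norm_nonneg _) (div_le_one_of_le₀ hxy (norm_nonneg y))

theorem lintegral_grassmannMeasure_norm_proj_le (h : m ≤ n) {ρ : ℝ} (hρ : 0 ≤ ρ) :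
    ∫⁻ x in Metric.closedBall (0 : Euc n) 1, grassmannMeasure h {V | ‖V.proj x‖ ≤ ρ} ≤
      ENNReal.ofReal (ρ ^ m) * (volume (Metric.ball (0 : Euc m) 1) *
        volume (Metric.closedBall (0 : Euc (n - m)) 1)) := by
  have hS : MeasurableSet {p : Grassmannian n m × Euc n | ‖p.1.proj p.2‖ ≤ ρ} :=
    (isClosed_le Grassmannian.continuous_norm_proj continuous_const).measurableSet
  have hfubini := (Measure.prod_apply_symm (μ := grassmannMeasure h)
    (ν := volume.restrict (Metric.closedBall (0 : Euc n) 1)) hS).symm.trans (Measure.prod_apply hS)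
  have hslab : ∀ V : Grassmannian n m,
      volume.restrict (Metric.closedBall (0 : Euc n) 1) {x | ‖V.proj x‖ ≤ ρ} ≤
        ENNReal.ofReal (ρ ^ m) * (volume (Metric.ball (0 : Euc m) 1) *
          volume (Metric.closedBall (0 : Euc (n - m)) 1)) := fun V => by
    have hV : Module.finrank ℝ V.1ᗮ = n - m := by
      have := V.1.finrank_add_finrank_orthogonal
      rw [V.2, finrank_euclideanSpace_fin] at this
      omega
    have hvol := volume_slab_le V.1 hρ
    rw [V.2, hV] at hvol
    refine le_trans (le_of_eq ?_) hvol
    rw [Measure.restrict_apply (show MeasurableSet {x | ‖V.proj x‖ ≤ ρ} from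
      measurable_prodMk_left hS)]
    congr 1
    ext x
    simp [Grassmannian.proj, and_comm]
  exact hfubini.le.trans ((lintegral_mono hslab).trans (by simp))

theorem exists_grassmannMeasure_norm_proj_le (h : m ≤ n) :
    ∃ c : ℝ, 0 < c ∧ ∀ ρ : ℝ, 0 ≤ ρ → ∀ x : Euc n, x ≠ 0 →
      grassmannMeasure h {V | ‖V.proj x‖ ≤ ρ} ≤ ENNReal.ofReal (c * (ρ / ‖x‖) ^ m) := by
  set v := volume (Metric.closedBall (0 : Euc n) 1)
  set κ := volume (Metric.ball (0 : Euc m) 1) * volume (Metric.closedBall (0 : Euc (n - m)) 1)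
  have hv₀ : v ≠ 0 := (Metric.measure_closedBall_pos _ _ one_pos).ne'
  have hv : v ≠ ⊤ := measure_closedBall_lt_top.ne
  have hκ₀ : κ ≠ 0 := mul_ne_zero (Metric.measure_ball_pos _ _ one_pos).ne'
    (Metric.measure_closedBall_pos _ _ one_pos).ne'
  have hκ : κ ≠ ⊤ := ENNReal.mul_ne_top measure_ball_lt_top.ne measure_closedBall_lt_top.ne
  have hc : κ / v ≠ ⊤ := ENNReal.div_ne_top hκ hv₀
  refine ⟨(κ / v).toReal, ENNReal.toReal_pos (ENNReal.div_ne_zero.mpr ⟨hκ₀, hv⟩) hc,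
    fun ρ hρ x hx => ?_⟩
  have hx₀ : 0 < ‖x‖ := norm_pos_iff.mpr hx
  set u := ‖x‖⁻¹ • x
  have hscale : {V : Grassmannian n m | ‖V.proj x‖ ≤ ρ} = {V | ‖V.proj u‖ ≤ ρ / ‖x‖} := by
    ext V
    rw [mem_ofPred_eq, mem_ofPred_eq, map_smul, norm_smul, norm_inv, norm_norm, ← div_eq_inv_mul,
      div_le_div_iff_of_pos_right hx₀]
  have hunit : grassmannMeasure h {V | ‖V.proj u‖ ≤ ρ / ‖x‖} * v ≤
      ENNReal.ofReal ((ρ / ‖x‖) ^ m) * κ := by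
    rw [← setLIntegral_const]
    refine le_trans (setLIntegral_mono' Metric.isClosed_closedBall.measurableSet fun y hy => ?_)
      (lintegral_grassmannMeasure_norm_proj_le h (by positivity))
    refine grassmannMeasure_norm_proj_le_anti h _ ?_
    exact (mem_closedBall_zero_iff.mp hy).trans_eq (norm_smul_inv_norm (𝕜 := ℝ) hx).symm
  rw [hscale, ENNReal.ofReal_mul ENNReal.toReal_nonneg, ENNReal.ofReal_toReal hc, mul_comm,
    ← mul_div_assoc]
  exact (ENNReal.le_div_iff_mul_le (.inl hv₀) (.inl hv)).mpr hunit

theorem isTransversal_proj (h : m ≤ n) :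
    IsTransversal (grassmannMeasure h) (fun V : Grassmannian n m => ⇑V.proj) m := by
  obtain ⟨c, hc, H⟩ := exists_grassmannMeasure_norm_proj_le h
  refine ⟨fun x y => ?_, c, hc, fun ρ hρ x y hxy => ?_⟩
  · simp only [dist_eq_norm, ← map_sub]
    exact (Grassmannian.continuous_norm_proj.comp (by fun_prop :
      Continuous fun V : Grassmannian n m => (V, x - y))).measurable
  · simpa only [dist_eq_norm, ← map_sub, Real.rpow_natCast] using H ρ hρ.le _ (sub_ne_zero.mpr hxy)

end Grassmannian

/-! ### Covering numbers and nets -/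

section Covering

variable {X : Type*} [MetricSpace X] {r : ℝ} {E F : Set X}

theorem coveringNumber_mono (h : E ⊆ F) : coveringNumber r E ≤ coveringNumber r F :=
  le_iInf₂ fun 𝒰 h𝒰 => iInf₂_le 𝒰 ⟨h𝒰.1, h.trans h𝒰.2⟩

theorem coveringNumber_anti {r' : ℝ} (h : r ≤ r') : coveringNumber r' F ≤ coveringNumber r F :=
  le_iInf₂ fun 𝒰 h𝒰 => iInf₂_le 𝒰
    ⟨fun U hU => (h𝒰.1 U hU).trans (ENNReal.ofReal_le_ofReal h), h𝒰.2⟩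

theorem coveringNumber_empty : coveringNumber r (∅ : Set X) = 0 :=
  nonpos_iff_eq_zero.mp (iInf₂_le_of_le ∅ ⟨by simp, empty_subset _⟩ encard_empty.le)

theorem exists_finset_cover_card_eq (h : coveringNumber r F ≠ ⊤) :
    ∃ 𝒰 : Finset (Set X), (∀ U ∈ 𝒰, Metric.ediam U ≤ ENNReal.ofReal r) ∧ F ⊆ ⋃₀ ↑𝒰 ∧
      coveringNumber r F = 𝒰.card := by
  obtain ⟨𝒰, h𝒰⟩ := ciInf_mem fun 𝒰 : Set (Set X) =>
    ⨅ _ : (∀ U ∈ 𝒰, Metric.ediam U ≤ ENNReal.ofReal r) ∧ F ⊆ ⋃₀ 𝒰, 𝒰.encard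
  change (⨅ _ : (∀ U ∈ 𝒰, Metric.ediam U ≤ ENNReal.ofReal r) ∧ F ⊆ ⋃₀ 𝒰, 𝒰.encard) =
    coveringNumber r F at h𝒰
  by_cases hcov : (∀ U ∈ 𝒰, Metric.ediam U ≤ ENNReal.ofReal r) ∧ F ⊆ ⋃₀ 𝒰
  · rw [iInf_pos hcov] at h𝒰
    lift 𝒰 to Finset (Set X) using encard_ne_top_iff.mp (h𝒰 ▸ h)
    exact ⟨𝒰, hcov.1, hcov.2, h𝒰.symm.trans (encard_coe_eq_coe_finsetCard _)⟩
  · rw [iInf_neg hcov] at h𝒰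
    exact absurd h𝒰.symm h

theorem dist_le_of_mem_of_ediam_le (hr : 0 ≤ r) {U : Set X} (hU : Metric.ediam U ≤ ENNReal.ofReal r)
    {p q : X} (hp : p ∈ U) (hq : q ∈ U) : dist p q ≤ r :=
  (edist_le_ofReal hr).mp ((Metric.edist_le_ediam_of_mem hp hq).trans hU)

theorem encard_le_coveringNumber {S : Set X} (hSF : S ⊆ F)
    (hS : Metric.IsSeparated (ENNReal.ofReal r) S) : S.encard ≤ coveringNumber r F := by
  refine le_iInf₂ fun 𝒰 h𝒰 => ?_
  have hex : ∀ p ∈ S, ∃ U ∈ 𝒰, p ∈ U := fun p hp => h𝒰.2 (hSF hp)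
  choose! u hu hpu using hex
  refine encard_le_encard_of_injOn hu fun p hp q hq hpq => ?_
  by_contra hne
  exact (hS hp hq hne).not_ge
    ((Metric.edist_le_ediam_of_mem (hpu p hp) (hpq ▸ hpu q hq)).trans (h𝒰.1 _ (hu p hp)))

theorem coveringNumber_two_mul_le_card {P : Finset X}
    (hF : F ⊆ ⋃ p ∈ P, Metric.closedBall p r) : coveringNumber (2 * r) F ≤ P.card := by
  have hdiam : ∀ p : X, Metric.ediam (Metric.closedBall p r) ≤ ENNReal.ofReal (2 * r) := fun p =>
    Metric.ediam_le fun x hx y hy => by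
      rw [edist_dist]
      refine ENNReal.ofReal_le_ofReal ((dist_triangle_right x y p).trans ?_)
      rw [two_mul]
      exact add_le_add hx hy
  calc coveringNumber (2 * r) F
      ≤ ((fun p => Metric.closedBall p r) '' (P : Set X)).encard :=
        iInf₂_le _ ⟨forall_mem_image.mpr fun p _ => hdiam p, by rwa [sUnion_image]⟩
    _ ≤ (P : Set X).encard := encard_image_le _ _
    _ = P.card := encard_coe_eq_coe_finsetCard P

/-- A maximal `δ`-separated subset of `F`: its points are more than `δ` apart, and the closed
`δ`-balls around them cover `F`. -/
structure IsNet (δ : ℝ) (F : Set X) (P : Finset X) : Prop where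
  subset : ↑P ⊆ F
  isSeparated : Metric.IsSeparated (ENNReal.ofReal δ) (P : Set X)
  subset_iUnion_closedBall : F ⊆ ⋃ p ∈ P, Metric.closedBall p δ

theorem exists_isNet {δ : ℝ} (hδ : 0 ≤ δ) (h : coveringNumber δ F ≠ ⊤) :
    ∃ P : Finset X, IsNet δ F P := by
  lift δ to NNReal using hδ
  have hpack : Metric.packingNumber δ F ≠ ⊤ := ne_top_of_le_ne_top h <|
    iSup₂_le fun S hS => iSup_le fun hsep =>
      encard_le_coveringNumber hS (by rwa [ENNReal.ofReal_coe_nnreal])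
  have hfin : (Metric.maximalSeparatedSet δ F).Finite := by
    rwa [← encard_ne_top_iff, Metric.encard_maximalSeparatedSet hpack]
  have hcover := Metric.isCover_iff_subset_iUnion_closedBall.mp
    (Metric.isCover_maximalSeparatedSet hpack)
  refine ⟨hfin.toFinset, ?_, ?_, ?_⟩
  · simpa only [hfin.coe_toFinset] using Metric.maximalSeparatedSet_subset
  · simpa only [hfin.coe_toFinset, ENNReal.ofReal_coe_nnreal] using
      Metric.isSeparated_maximalSeparatedSet
  · simpa only [hfin.mem_toFinset] using hcover

theorem totallyBounded_of_coveringNumber_ne_top (h : ∀ r > 0, coveringNumber r F ≠ ⊤) :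
    TotallyBounded F := by
  refine Metric.totallyBounded_iff.mpr fun ε hε => ?_
  obtain ⟨P, hP⟩ := exists_isNet (half_pos hε).le (h _ (half_pos hε))
  exact ⟨P, P.finite_toSet, hP.subset_iUnion_closedBall.trans
    (iUnion₂_mono fun p _ => Metric.closedBall_subset_ball (half_lt_self hε))⟩

end Covering

section ClosePairs

variable {X Y : Type*} [MetricSpace Y]

/-- The ordered pairs of points of `P` that `f` sends to within `ρ` of each other. -/
noncomputable def closePairs (f : X → Y) (P : Finset X) (ρ : ℝ) : Finset (X × X) :=
  {p ∈ P ×ˢ P | dist (f p.1) (f p.2) ≤ ρ}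

open Classical in
theorem sq_card_le_card_mul_card_fiber_pairs {ι κ : Type*} {P : Finset ι} {T : Finset κ}
    {u : ι → κ} (hu : ∀ p ∈ P, u p ∈ T) :
    #P ^ 2 ≤ #T * #{p ∈ P ×ˢ P | u p.1 = u p.2} := by
  have hfiber : ∀ k, {p ∈ {p ∈ P ×ˢ P | u p.1 = u p.2} | u p.1 = k} =
      {p ∈ P | u p = k} ×ˢ {p ∈ P | u p = k} := fun k => by
    ext p; simp only [Finset.mem_filter, Finset.mem_product]; grind
  calc #P ^ 2 = (∑ k ∈ T, #{p ∈ P | u p = k}) ^ 2 := by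
        rw [← Finset.card_eq_sum_card_fiberwise hu]
    _ ≤ #T * ∑ k ∈ T, #{p ∈ P | u p = k} ^ 2 := sq_sum_le_card_mul_sum_sq
    _ = #T * #{p ∈ P ×ˢ P | u p.1 = u p.2} := by
        rw [Finset.card_eq_sum_card_fiberwise (f := fun p : ι × ι => u p.1) (t := T)]
        · simp only [hfiber, Finset.card_product, sq]
        · exact fun p hp => hu _ (Finset.mem_product.mp (Finset.mem_filter.mp hp).1).1

theorem sq_card_le_coveringNumber_mul {r : ℝ} (hr : 0 ≤ r) (f : X → Y) {P : Finset X} {F : Set X}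
    (hP : ↑P ⊆ F) :
    (#P : ENNReal) ^ 2 ≤
      (coveringNumber r (f '' F) : ENNReal) * (#(closePairs f P r) : ENNReal) := by
  classical
  rcases P.eq_empty_or_nonempty with rfl | ⟨p, hp⟩
  · simp
  by_cases htop : coveringNumber r (f '' F) = ⊤
  · have hdiag : (p, p) ∈ closePairs f P r := by simp [closePairs, hp, hr]
    have hcard : (#(closePairs f P r) : ENNReal) ≠ 0 := by
      exact_mod_cast Finset.card_ne_zero_of_mem hdiag
    simp [htop, ENNReal.top_mul hcard]
  obtain ⟨𝒰, hdiam, hcov, hcard⟩ := exists_finset_cover_card_eq htop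
  have hex : ∀ p ∈ P, ∃ U ∈ 𝒰, f p ∈ U := fun p hp => hcov ⟨p, hP hp, rfl⟩
  choose! u hu hpu using hex
  have hclose : {p ∈ P ×ˢ P | u p.1 = u p.2} ⊆ closePairs f P r := fun p hp => by
    obtain ⟨hpP, hup⟩ := Finset.mem_filter.mp hp
    obtain ⟨hp₁, hp₂⟩ := Finset.mem_product.mp hpP
    exact Finset.mem_filter.mpr
      ⟨hpP, dist_le_of_mem_of_ediam_le hr (hdiam _ (hu _ hp₁)) (hpu _ hp₁) (hup ▸ hpu _ hp₂)⟩
  rw [hcard]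
  exact_mod_cast (sq_card_le_card_mul_card_fiber_pairs hu).trans
    (Nat.mul_le_mul_left _ (Finset.card_le_card hclose))

end ClosePairs

/-! ### Assouad-type exponents and the distribution of nets -/

section Asymptotics

theorem eventually_mul_rpow_neg_le {M M' : ℝ} (h : M < M') (A : ℝ) :
    ∀ᶠ δ : ℝ in 𝓝[>] 0, A * δ ^ (-M) ≤ δ ^ (-M') := by
  have hlim : Tendsto (fun δ : ℝ => δ ^ (-(M' - M))) (𝓝[>] 0) atTop :=
    tendsto_rpow_neg_nhdsGT_zero (neg_neg_of_pos (sub_pos.mpr h))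
  filter_upwards [hlim.eventually_ge_atTop A, self_mem_nhdsWithin] with δ hA hδ
  calc A * δ ^ (-M) ≤ δ ^ (-(M' - M)) * δ ^ (-M) :=
        mul_le_mul_of_nonneg_right hA (Real.rpow_nonneg (le_of_lt hδ) _)
    _ = δ ^ (-M') := by rw [← Real.rpow_add hδ]; congr 1; ring

theorem eventually_harmonic_le {D ε : ℝ} (hD : 0 ≤ D) (hε : 0 < ε) :
    ∀ᶠ δ : ℝ in 𝓝[>] 0, ∀ N : ℕ, (N : ℝ) ≤ δ ^ (-D) → (harmonic N : ℝ) ≤ δ ^ (-ε) := by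
  filter_upwards [eventually_mul_rpow_neg_le (half_lt_self hε) (1 + D / (ε / 2)),
    Ioo_mem_nhdsGT one_pos] with δ hδε ⟨hδ₀, hδ₁⟩ N hN
  rcases N.eq_zero_or_pos with rfl | hN₀
  · simpa using Real.rpow_nonneg hδ₀.le _
  have hone : 1 ≤ δ ^ (-(ε / 2)) :=
    Real.one_le_rpow_of_pos_of_le_one_of_nonpos hδ₀ hδ₁.le (by linarith)
  have hlogN : Real.log N ≤ D * Real.log δ⁻¹ := by
    rw [Real.log_inv, mul_neg, ← neg_mul, ← Real.log_rpow hδ₀]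
    exact Real.log_le_log (by exact_mod_cast hN₀) hN
  have hlog : Real.log δ⁻¹ ≤ δ ^ (-(ε / 2)) / (ε / 2) := by
    simpa only [Real.inv_rpow hδ₀.le, ← Real.rpow_neg hδ₀.le] using
      Real.log_le_rpow_div (inv_nonneg.mpr hδ₀.le) (half_pos hε)
  calc (harmonic N : ℝ) ≤ 1 + Real.log N := harmonic_le_one_add_log N
    _ ≤ δ ^ (-(ε / 2)) + D * (δ ^ (-(ε / 2)) / (ε / 2)) :=
        add_le_add hone (hlogN.trans (mul_le_mul_of_nonneg_left hlog hD))
    _ = (1 + D / (ε / 2)) * δ ^ (-(ε / 2)) := by ring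
    _ ≤ δ ^ (-ε) := hδε

theorem rpow_le_rpow_neg_mul_rpow {b δ a s m M : ℝ} (hδ₀ : 0 < δ) (hδ₁ : δ ≤ 1) (hb : 1 ≤ b)
    (hba : b ≤ δ ^ (-a)) (hM : 0 ≤ M) (hsM : (s - m) * a ≤ M) :
    b ^ s ≤ δ ^ (-M) * b ^ m := by
  have hb₀ : 0 < b := one_pos.trans_le hb
  have key : b ^ (s - m) ≤ δ ^ (-M) := by
    rcases le_or_gt (s - m) 0 with h | h
    · exact (Real.rpow_le_one_of_one_le_of_nonpos hb h).trans
        (Real.one_le_rpow_of_pos_of_le_one_of_nonpos hδ₀ hδ₁ (neg_nonpos.mpr hM))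
    · calc b ^ (s - m) ≤ (δ ^ (-a)) ^ (s - m) := Real.rpow_le_rpow hb₀.le hba h.le
        _ = δ ^ (-a * (s - m)) := (Real.rpow_mul hδ₀.le _ _).symm
        _ ≤ δ ^ (-M) := Real.rpow_le_rpow_of_exponent_ge hδ₀ hδ₁ (by linarith)
  calc b ^ s = b ^ (s - m) * b ^ m := by rw [← Real.rpow_add hb₀, sub_add_cancel]
    _ ≤ δ ^ (-M) * b ^ m := mul_le_mul_of_nonneg_right key (Real.rpow_nonneg hb₀.le _)

end Asymptotics

section BallCount

variable {X : Type*} [MetricSpace X]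

/-- The number of points of `P` in the closed ball of radius `R` about `x`. -/
noncomputable def ballCount (P : Finset X) (x : X) (R : ℝ) : ℕ :=
  #{z ∈ P | dist z x ≤ R}

theorem ballCount_mono (P : Finset X) (x : X) {R R' : ℝ} (h : R ≤ R') :
    ballCount P x R ≤ ballCount P x R' :=
  Finset.card_le_card (Finset.monotone_filter_right P fun _ _ hz => hz.trans h)

theorem ballCount_le_of_coveringNumber_le {δ B R : ℝ} (hB : 0 ≤ B) {F : Set X} {P : Finset X}
    (hP : IsNet δ F P) {x : X}
    (h : (coveringNumber δ (Metric.closedBall x R ∩ F) : ENNReal) ≤ ENNReal.ofReal B) :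
    (ballCount P x R : ℝ) ≤ B := by
  have hsub : {z | z ∈ P ∧ dist z x ≤ R} ⊆ (P : Set X) := fun z hz => hz.1
  have hball : (ballCount P x R : ℕ∞) ≤ coveringNumber δ (Metric.closedBall x R ∩ F) := by
    rw [ballCount, ← encard_coe_eq_coe_finsetCard, Finset.coe_filter]
    exact encard_le_coveringNumber (fun z hz => ⟨hz.2, hP.subset hz.1⟩) (hP.isSeparated.mono hsub)
  have hle : ((ballCount P x R : ℕ∞) : ENNReal) ≤ ENNReal.ofReal B :=
    (ENat.toENNReal_mono hball).trans h
  rw [ENat.toENNReal_coe, ← ENNReal.ofReal_natCast] at hle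
  exact (ENNReal.ofReal_le_ofReal_iff hB).mp hle

theorem card_le_sum_ballCount {F : Set X} {P Q : Finset X} {R : ℝ} (hPF : ↑P ⊆ F)
    (hQ : F ⊆ ⋃ q ∈ Q, Metric.closedBall q R) : #P ≤ ∑ q ∈ Q, ballCount P q R := by
  classical
  refine (Finset.card_le_card fun z hz => ?_).trans Finset.card_biUnion_le
  obtain ⟨q, hq, hzq⟩ := mem_iUnion₂.mp (hQ (hPF hz))
  exact Finset.mem_biUnion.mpr ⟨q, hq, Finset.mem_filter.mpr ⟨hz, hzq⟩⟩

/-- The Katz–Tao condition with constant `B` at scale `δ`: balls of radius `R ≥ δ` centred on `P`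
contain at most `B (R / δ) ^ m` points of `P`. -/
def IsKatzTao (m δ B : ℝ) (P : Finset X) : Prop :=
  ∀ x ∈ P, ∀ R, δ ≤ R → (ballCount P x R : ℝ) ≤ B * (R / δ) ^ m

-- Layer-cake summation: the `k`-th largest value of `g` is at most `A / k`.
theorem sum_le_mul_harmonic {ι : Type*} {A : ℝ} {g : ι → ℝ} (P : Finset ι)
    (h : ∀ y ∈ P, (#{z ∈ P | g y ≤ g z} : ℝ) * g y ≤ A) (hg : ∀ y, 0 ≤ g y) :
    ∑ y ∈ P, g y ≤ A * (harmonic #P : ℝ) := by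
  classical
  induction hn : #P generalizing P with
  | zero => simp [Finset.card_eq_zero.mp hn]
  | succ k ih =>
    obtain ⟨y, hy, hmin⟩ := P.exists_min_image g (Finset.card_pos.mp (hn ▸ k.succ_pos))
    have hgy : g y ≤ A * ((k + 1 : ℕ) : ℝ)⁻¹ := by
      have hy' := h y hy
      rw [Finset.filter_true_of_mem hmin, hn] at hy'
      rwa [← div_eq_mul_inv, le_div_iff₀' (by positivity)]
    have hrest : ∑ z ∈ P.erase y, g z ≤ A * (harmonic k : ℝ) := by
      refine ih (P.erase y) (fun z hz => ?_) (by rw [Finset.card_erase_of_mem hy, hn]; rfl)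
      refine le_trans ?_ (h z (Finset.mem_of_mem_erase hz))
      gcongr
      · exact hg z
      · exact P.erase_subset y
    rw [← Finset.sum_erase_add P g hy, harmonic_succ]
    push_cast at hgy ⊢
    linarith

theorem IsKatzTao.sum_div_max_dist_rpow_le {m δ B : ℝ} (hm : 0 < m) (hδ : 0 < δ) {P : Finset X}
    (hP : IsKatzTao m δ B P) {x : X} (hx : x ∈ P) :
    ∑ y ∈ P, (δ / max δ (dist y x)) ^ m ≤ B * (harmonic #P : ℝ) := by
  have hmax : ∀ y, 0 < max δ (dist y x) := fun y => hδ.trans_le (le_max_left _ _)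
  refine sum_le_mul_harmonic P (fun y _ => ?_) fun y =>
    Real.rpow_nonneg (div_nonneg hδ.le (hmax y).le) _
  have hlevel : #{z ∈ P | (δ / max δ (dist y x)) ^ m ≤ (δ / max δ (dist z x)) ^ m} ≤
      ballCount P x (max δ (dist y x)) := by
    refine Finset.card_le_card (Finset.monotone_filter_right P fun z _ hz => ?_)
    rw [Real.rpow_le_rpow_iff (div_nonneg hδ.le (hmax y).le) (div_nonneg hδ.le (hmax z).le) hm,
      div_le_div_iff_of_pos_left hδ (hmax y) (hmax z)] at hz
    exact (le_max_right _ _).trans hz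
  rw [← inv_div, Real.inv_rpow (div_nonneg (hmax y).le hδ.le), ← div_eq_mul_inv,
    div_le_iff₀ (Real.rpow_pos_of_pos (div_pos (hmax y) hδ) m)]
  rw [← inv_div, Real.inv_rpow (div_nonneg (hmax y).le hδ.le)] at hlevel
  exact (Nat.cast_le.mpr hlevel).trans (hP x hx _ (le_max_left _ _))

end BallCount

section Exponents

variable {X : Type*} [MetricSpace X] {E F : Set X} {θ s t m M : ℝ}

/-- `s` is admissible in the definition of the Assouad dimension of `F`. -/
def IsAssouadExponent (F : Set X) (s : ℝ) : Prop :=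
  ∃ C : ℝ, 0 < C ∧ ∀ r R : ℝ, 0 < r → r < R → ∀ x ∈ F,
    (coveringNumber r (Metric.closedBall x R ∩ F) : ENNReal) ≤ ENNReal.ofReal (C * (R / r) ^ s)

/-- `t` is admissible in the definition of the upper Assouad spectrum of `F` at `θ`. -/
def IsSpectrumExponent (θ : ℝ) (F : Set X) (t : ℝ) : Prop :=
  ∃ C : ℝ, 0 < C ∧ ∀ r R : ℝ, 0 < r → 0 < R → R < 1 → r ≤ R ^ (1 / θ) → ∀ x ∈ F,
    (coveringNumber r (Metric.closedBall x R ∩ F) : ENNReal) ≤ ENNReal.ofReal (C * (R / r) ^ t)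

theorem IsAssouadExponent.mono (h : IsAssouadExponent F s) (hEF : E ⊆ F) :
    IsAssouadExponent E s := by
  obtain ⟨C, hC, H⟩ := h
  exact ⟨C, hC, fun r R hr hR x hx => (ENat.toENNReal_mono
    (coveringNumber_mono (inter_subset_inter_right _ hEF))).trans (H r R hr hR x (hEF hx))⟩

theorem IsSpectrumExponent.mono (h : IsSpectrumExponent θ F t) (hEF : E ⊆ F) :
    IsSpectrumExponent θ E t := by
  obtain ⟨C, hC, H⟩ := h
  exact ⟨C, hC, fun r R hr h₀ h₁ hR x hx => (ENat.toENNReal_mono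
    (coveringNumber_mono (inter_subset_inter_right _ hEF))).trans (H r R hr h₀ h₁ hR x (hEF hx))⟩

theorem IsAssouadExponent.coveringNumber_ne_top (hs : IsAssouadExponent F s)
    (hF : Bornology.IsBounded F) {r : ℝ} (hr : 0 < r) : coveringNumber r F ≠ ⊤ := by
  obtain ⟨C, -, H⟩ := hs
  rcases F.eq_empty_or_nonempty with rfl | ⟨x, hx⟩
  · simp [coveringNumber_empty]
  obtain ⟨R, hrR, hFR⟩ := hF.subset_closedBall_lt r x
  have h := H r R hr hrR x hx
  rw [inter_eq_self_of_subset_right hFR] at h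
  exact ENat.toENNReal_ne_top.mp (ne_top_of_le_ne_top ENNReal.ofReal_ne_top h)

theorem IsAssouadExponent.eventually_ballCount_le (hs : IsAssouadExponent F s) (hM : 0 < M)
    (hsM : (s - m) * (1 - θ) < M) :
    ∀ᶠ δ : ℝ in 𝓝[>] 0, ∀ P : Finset X, IsNet δ F P → ∀ x ∈ F, ∀ R, δ ≤ R → R ≤ δ ^ θ →
      (ballCount P x R : ℝ) ≤ δ ^ (-M) * (R / δ) ^ m := by
  obtain ⟨C, hC, H⟩ := hs
  filter_upwards [eventually_mul_rpow_neg_le (max_lt hM hsM) (C * 2 ^ s),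
    Ioo_mem_nhdsGT one_pos] with δ hδM ⟨hδ₀, hδ₁⟩ P hP x hx R hδR hRθ
  have hR : 0 < R := hδ₀.trans_le hδR
  have hb : R / δ ≤ δ ^ (-(1 - θ)) := by
    rw [neg_sub, Real.rpow_sub_one hδ₀.ne']
    exact div_le_div_of_nonneg_right hRθ hδ₀.le
  have hrpow := rpow_le_rpow_neg_mul_rpow hδ₀ hδ₁.le ((one_le_div hδ₀).mpr hδR) hb
    (le_max_left 0 _) (le_max_right 0 ((s - m) * (1 - θ)))
  calc (ballCount P x R : ℝ) ≤ ballCount P x (2 * R) :=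
        Nat.cast_le.mpr (ballCount_mono P x (by linarith))
    _ ≤ C * (2 * R / δ) ^ s :=
        ballCount_le_of_coveringNumber_le (by positivity) hP (H δ (2 * R) hδ₀ (by linarith) x hx)
    _ = C * 2 ^ s * (R / δ) ^ s := by
        rw [mul_div_assoc, Real.mul_rpow (by norm_num) (by positivity), mul_assoc]
    _ ≤ C * 2 ^ s * (δ ^ (-max 0 ((s - m) * (1 - θ))) * (R / δ) ^ m) := by gcongr
    _ ≤ δ ^ (-M) * (R / δ) ^ m := by rw [← mul_assoc]; gcongr

theorem IsSpectrumExponent.eventually_ballCount_le (hθ : 0 < θ) (ht : IsSpectrumExponent θ F t)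
    (hM : 0 < M) (htM : t - m < M) :
    ∀ᶠ δ : ℝ in 𝓝[>] 0, ∀ P : Finset X, IsNet δ F P → ∀ x ∈ F, ∀ R, δ ≤ R → δ ^ θ ≤ R → R < 1 →
      (ballCount P x R : ℝ) ≤ δ ^ (-M) * (R / δ) ^ m := by
  obtain ⟨C, hC, H⟩ := ht
  filter_upwards [eventually_mul_rpow_neg_le (max_lt hM htM) C,
    Ioo_mem_nhdsGT one_pos] with δ hδM ⟨hδ₀, hδ₁⟩ P hP x hx R hδR hθR hR₁
  have hR : 0 < R := hδ₀.trans_le hδR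
  have hδθ : δ ≤ R ^ (1 / θ) := by
    rwa [one_div, Real.le_rpow_inv_iff_of_pos hδ₀.le hR.le hθ]
  have hb : R / δ ≤ δ ^ (-(1 : ℝ)) := by
    rw [Real.rpow_neg_one, ← one_div]
    exact div_le_div_of_nonneg_right hR₁.le hδ₀.le
  have hrpow := rpow_le_rpow_neg_mul_rpow hδ₀ hδ₁.le ((one_le_div hδ₀).mpr hδR) hb
    (le_max_left 0 _) ((mul_one (t - m)).trans_le (le_max_right 0 _))
  calc (ballCount P x R : ℝ) ≤ C * (R / δ) ^ t :=
        ballCount_le_of_coveringNumber_le (by positivity) hP (H δ R hδ₀ hR hR₁ hδθ x hx)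
    _ ≤ C * (δ ^ (-max 0 (t - m)) * (R / δ) ^ m) := by gcongr
    _ ≤ δ ^ (-M) * (R / δ) ^ m := by rw [← mul_assoc]; gcongr

theorem IsSpectrumExponent.eventually_card_le (hθ : 0 < θ) (ht : IsSpectrumExponent θ F t)
    (hm : 0 ≤ m) (hM : 0 < M) (htM : t - m < M) (hF : coveringNumber (1 / 2) F ≠ ⊤) :
    ∀ᶠ δ : ℝ in 𝓝[>] 0, ∀ P : Finset X, IsNet δ F P → (#P : ℝ) ≤ δ ^ (-M) * (1 / δ) ^ m := by
  obtain ⟨Q, hQ⟩ := exists_isNet (by norm_num) hF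
  obtain ⟨M₀, hM₀, hM₀M⟩ := exists_between (max_lt hM htM)
  rw [max_lt_iff] at hM₀
  have hδθ : ∀ᶠ δ : ℝ in 𝓝[>] 0, δ ^ θ ≤ 1 / 2 := by
    have hlim : Tendsto (fun δ : ℝ => δ ^ θ) (𝓝[>] 0) (𝓝 (0 ^ θ)) :=
      (Real.continuous_rpow_const hθ.le).continuousAt.mono_left nhdsWithin_le_nhds
    rw [Real.zero_rpow hθ.ne'] at hlim
    exact hlim.eventually_le_const (by norm_num)
  filter_upwards [ht.eventually_ballCount_le hθ hM₀.1 hM₀.2, hδθ,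
    eventually_mul_rpow_neg_le hM₀M #Q, Ioo_mem_nhdsGT (half_pos one_pos)]
    with δ hball hδθ hδM ⟨hδ₀, hδ₁⟩ P hP
  calc (#P : ℝ) ≤ ∑ q ∈ Q, (ballCount P q (1 / 2) : ℝ) := by
        exact_mod_cast card_le_sum_ballCount hP.subset hQ.subset_iUnion_closedBall
    _ ≤ ∑ _q ∈ Q, δ ^ (-M₀) * (1 / 2 / δ) ^ m := Finset.sum_le_sum fun q hq =>
        hball P hP q (hQ.subset hq) (1 / 2) hδ₁.le hδθ (by norm_num)
    _ = #Q * δ ^ (-M₀) * (1 / 2 / δ) ^ m := by rw [Finset.sum_const, nsmul_eq_mul, mul_assoc]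
    _ ≤ δ ^ (-M) * (1 / δ) ^ m := by gcongr; norm_num

theorem eventually_isKatzTao (hθ : 0 < θ) (hs : IsAssouadExponent F s)
    (ht : IsSpectrumExponent θ F t) (hF : coveringNumber (1 / 2) F ≠ ⊤) (hm : 0 ≤ m) (hM : 0 < M)
    (hsM : (s - m) * (1 - θ) < M) (htM : t - m < M) :
    ∀ᶠ δ : ℝ in 𝓝[>] 0, ∀ P : Finset X, IsNet δ F P → IsKatzTao m δ (δ ^ (-M)) P := by
  filter_upwards [hs.eventually_ballCount_le hM hsM, ht.eventually_ballCount_le hθ hM htM,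
    ht.eventually_card_le hθ hm hM htM hF, self_mem_nhdsWithin]
    with δ hsmall hmedium hlarge hδ P hP x hx R hδR
  replace hδ : 0 < δ := hδ
  rcases le_total R (δ ^ θ) with hRθ | hRθ
  · exact hsmall P hP x (hP.subset hx) R hδR hRθ
  rcases lt_or_ge R 1 with hR₁ | hR₁
  · exact hmedium P hP x (hP.subset hx) R hδR hRθ hR₁
  · calc (ballCount P x R : ℝ) ≤ #P := Nat.cast_le.mpr (Finset.card_filter_le _ _)
      _ ≤ δ ^ (-M) * (1 / δ) ^ m := hlarge P hP
      _ ≤ δ ^ (-M) * (R / δ) ^ m := by gcongr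

end Exponents

/-! ### Covering numbers of random images -/

section BorelCantelli

variable {Ω : Type*} [MeasurableSpace Ω] {μ : Measure Ω}

theorem measure_lt_le_of_lintegral_le {f : Ω → ENNReal} (hf : AEMeasurable f μ) {w a : ENNReal}
    (hw : w ≠ ⊤) (h : ∫⁻ ω, f ω ∂μ ≤ w * a) : μ {ω | w < f ω} ≤ a := by
  rcases eq_or_ne w 0 with rfl | hw₀
  · rw [zero_mul, nonpos_iff_eq_zero, lintegral_eq_zero_iff' hf] at h
    refine (measure_mono_null (fun ω hω => ?_) (ae_iff.mp h)).trans_le zero_le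
    exact (pos_iff_ne_zero.mp hω : f ω ≠ 0)
  · have hmarkov : w * μ {ω | w ≤ f ω} ≤ w * a := (mul_meas_ge_le_lintegral₀ hf w).trans h
    calc μ {ω | w < f ω} ≤ μ {ω | w ≤ f ω} := measure_mono fun ω (hω : w < f ω) => hω.le
      _ ≤ a := (ENNReal.mul_le_mul_iff_right hw₀ hw).mp hmarkov

theorem ae_eventually_le_of_lintegral_le {f : ℕ → Ω → ENNReal} (hf : ∀ k, AEMeasurable (f k) μ)
    {w a : ℕ → ENNReal} (hw : ∀ k, w k ≠ ⊤) (h : ∀ᶠ k in atTop, ∫⁻ ω, f k ω ∂μ ≤ w k * a k)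
    (ha : ∑' k, a k ≠ ⊤) : ∀ᵐ ω ∂μ, ∀ᶠ k in atTop, f k ω ≤ w k := by
  obtain ⟨k₀, hk₀⟩ := eventually_atTop.mp h
  have hsum : ∑' k, μ {ω | w (k + k₀) < f (k + k₀) ω} ≠ ⊤ := by
    refine ne_top_of_le_ne_top ha (le_trans (ENNReal.tsum_le_tsum fun k => ?_)
      (ENNReal.tsum_comp_le_tsum_of_injective (add_left_injective k₀) a))
    exact measure_lt_le_of_lintegral_le (hf _) (hw _) (hk₀ _ (Nat.le_add_left _ _))
  filter_upwards [ae_eventually_notMem hsum] with ω hω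
  rw [← map_add_atTop_eq_nat k₀, eventually_map]
  exact hω.mono fun k hk => not_lt.mp hk

end BorelCantelli

theorem IsNet.coveringNumber_le_of_card_closePairs_le {X Y : Type*} [MetricSpace X]
    [MetricSpace Y] {F : Set X} {δ : ℝ} (hδ : 0 ≤ δ) {P : Finset X} (hP : IsNet δ F P)
    {f : X → Y} {b : ENNReal}
    (h : #(closePairs f P (4 * δ)) ≤ #P * b) :
    (coveringNumber (2 * δ) F : ENNReal) ≤ b * coveringNumber (4 * δ) (f '' F) := by
  have hcard : (coveringNumber (2 * δ) F : ENNReal) ≤ #P := by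
    exact_mod_cast coveringNumber_two_mul_le_card hP.subset_iUnion_closedBall
  refine hcard.trans ?_
  rcases eq_or_ne (#P : ENNReal) 0 with h₀ | h₀
  · rw [h₀]; exact zero_le
  have hsq : (#P : ENNReal) * #P ≤ #P * (b * coveringNumber (4 * δ) (f '' F)) := by
    calc (#P : ENNReal) * #P = (#P : ENNReal) ^ 2 := (sq _).symm
      _ ≤ coveringNumber (4 * δ) (f '' F) * #(closePairs f P (4 * δ)) :=
          sq_card_le_coveringNumber_mul (by positivity) f hP.subset
      _ ≤ coveringNumber (4 * δ) (f '' F) * (#P * b) := by gcongr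
      _ = #P * (b * coveringNumber (4 * δ) (f '' F)) := by ring
  exact (ENNReal.mul_le_mul_iff_right h₀ (ENNReal.natCast_ne_top _)).mp hsq

theorem card_closePairs_eq_sum_indicator {Ω X Y : Type*} [MetricSpace Y] (π : Ω → X → Y)
    (P : Finset X) (ρ : ℝ) (ω : Ω) : (#(closePairs (π ω) P ρ) : ENNReal) =
      ∑ y ∈ P, ∑ x ∈ P, {ω | dist (π ω x) (π ω y) ≤ ρ}.indicator 1 ω := by
  classical
  rw [closePairs, Finset.card_filter, Nat.cast_sum, Finset.sum_product_right]
  refine Finset.sum_congr rfl fun y _ => Finset.sum_congr rfl fun x _ => ?_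
  by_cases h : dist (π ω x) (π ω y) ≤ ρ <;> simp [h]

section RandomImages

variable {Ω X Y : Type*} [MeasurableSpace Ω] [MetricSpace X] [MetricSpace Y] {μ : Measure Ω}
  {π : Ω → X → Y} {m : ℝ}

theorem IsTransversal.measurableSet_dist_le (hπ : IsTransversal μ π m) (x y : X) (ρ : ℝ) :
    MeasurableSet {ω | dist (π ω x) (π ω y) ≤ ρ} :=
  hπ.measurable_dist x y measurableSet_Iic

theorem IsTransversal.measurable_card_closePairs (hπ : IsTransversal μ π m) (P : Finset X)
    (ρ : ℝ) : Measurable fun ω => (#(closePairs (π ω) P ρ) : ENNReal) := by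
  simp only [card_closePairs_eq_sum_indicator π]
  exact Finset.measurable_fun_sum _ fun y _ => Finset.measurable_fun_sum _ fun x _ =>
    measurable_one.indicator (hπ.measurableSet_dist_le x y ρ)

theorem IsTransversal.lintegral_card_closePairs (hπ : IsTransversal μ π m) (P : Finset X)
    (ρ : ℝ) : ∫⁻ ω, (#(closePairs (π ω) P ρ) : ENNReal) ∂μ =
      ∑ y ∈ P, ∑ x ∈ P, μ {ω | dist (π ω x) (π ω y) ≤ ρ} := by
  have hind : ∀ x y : X, Measurable fun ω =>
      {ω | dist (π ω x) (π ω y) ≤ ρ}.indicator (1 : Ω → ENNReal) ω := fun x y =>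
    measurable_one.indicator (hπ.measurableSet_dist_le x y ρ)
  simp only [card_closePairs_eq_sum_indicator π]
  rw [lintegral_finsetSum _ fun y _ => Finset.measurable_fun_sum _ fun x _ => hind x y]
  refine Finset.sum_congr rfl fun y _ => ?_
  rw [lintegral_finsetSum _ fun x _ => hind x y]
  exact Finset.sum_congr rfl fun x _ => lintegral_indicator_one (hπ.measurableSet_dist_le x y ρ)

variable [IsFiniteMeasure μ]

theorem IsTransversal.exists_measure_dist_le_kernel (hπ : IsTransversal μ π m) :
    ∃ c, 0 < c ∧ ∀ δ, 0 < δ → ∀ x y : X, μ {ω | dist (π ω x) (π ω y) ≤ 4 * δ} ≤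
      ENNReal.ofReal (c * (δ / max δ (dist x y)) ^ m) := by
  obtain ⟨c, hc, H⟩ := hπ.exists_measure_dist_le
  have hμ : 0 ≤ μ.real univ := measureReal_nonneg
  have hc' : 0 < c * 4 ^ m := by positivity
  refine ⟨μ.real univ + c * 4 ^ m, by positivity, fun δ hδ x y => ?_⟩
  rcases le_or_gt (dist x y) δ with hd | hd
  · rw [max_eq_left hd, div_self hδ.ne', Real.one_rpow, mul_one]
    calc μ {ω | dist (π ω x) (π ω y) ≤ 4 * δ} ≤ μ univ := measure_mono (subset_univ _)
      _ = ENNReal.ofReal (μ.real univ) := (ofReal_measureReal (measure_ne_top μ univ)).symm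
      _ ≤ ENNReal.ofReal (μ.real univ + c * 4 ^ m) :=
          ENNReal.ofReal_le_ofReal (le_add_of_nonneg_right hc'.le)
  · have hxy : 0 < dist x y := hδ.trans hd
    refine (H (4 * δ) (by positivity) x y (dist_pos.mp hxy)).trans (ENNReal.ofReal_le_ofReal ?_)
    rw [max_eq_right hd.le, mul_div_assoc, Real.mul_rpow (by norm_num) (by positivity),
      ← mul_assoc]
    gcongr
    exact le_add_of_nonneg_left hμ

theorem IsTransversal.exists_lintegral_card_closePairs_le (hπ : IsTransversal μ π m) (hm : 0 < m) :
    ∃ c, 0 < c ∧ ∀ δ B, 0 < δ → ∀ P : Finset X, IsKatzTao m δ B P →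
      ∫⁻ ω, (#(closePairs (π ω) P (4 * δ)) : ENNReal) ∂μ ≤
        #P * ENNReal.ofReal (c * (B * (harmonic #P : ℝ))) := by
  obtain ⟨c, hc, H⟩ := hπ.exists_measure_dist_le_kernel
  refine ⟨c, hc, fun δ B hδ P hP => ?_⟩
  have hrow : ∀ y ∈ P, ∑ x ∈ P, μ {ω | dist (π ω x) (π ω y) ≤ 4 * δ} ≤
      ENNReal.ofReal (c * (B * (harmonic #P : ℝ))) := fun y hy => by
    calc ∑ x ∈ P, μ {ω | dist (π ω x) (π ω y) ≤ 4 * δ}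
        ≤ ∑ x ∈ P, ENNReal.ofReal (c * (δ / max δ (dist x y)) ^ m) :=
          Finset.sum_le_sum fun x _ => H δ hδ x y
      _ = ENNReal.ofReal (c * ∑ x ∈ P, (δ / max δ (dist x y)) ^ m) := by
          rw [Finset.mul_sum, ENNReal.ofReal_sum_of_nonneg fun x _ => by positivity]
      _ ≤ ENNReal.ofReal (c * (B * (harmonic #P : ℝ))) := ENNReal.ofReal_le_ofReal <|
          mul_le_mul_of_nonneg_left (hP.sum_div_max_dist_rpow_le hm hδ hy) hc.le
  calc ∫⁻ ω, (#(closePairs (π ω) P (4 * δ)) : ENNReal) ∂μ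
      = ∑ y ∈ P, ∑ x ∈ P, μ {ω | dist (π ω x) (π ω y) ≤ 4 * δ} :=
        hπ.lintegral_card_closePairs P (4 * δ)
    _ ≤ ∑ _y ∈ P, ENNReal.ofReal (c * (B * (harmonic #P : ℝ))) := Finset.sum_le_sum hrow
    _ = #P * ENNReal.ofReal (c * (B * (harmonic #P : ℝ))) := by
        rw [Finset.sum_const, nsmul_eq_mul]

variable {F : Set X} {θ s t M : ℝ}

theorem IsTransversal.eventually_lintegral_card_closePairs_le (hπ : IsTransversal μ π m)
    (hm : 0 < m) (hθ : 0 < θ) (hs : IsAssouadExponent F s) (ht : IsSpectrumExponent θ F t)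
    (hF : coveringNumber (1 / 2) F ≠ ⊤) (hM : 0 < M) (hsM : (s - m) * (1 - θ) < M)
    (htM : t - m < M) :
    ∀ᶠ δ : ℝ in 𝓝[>] 0, ∀ P : Finset X, IsNet δ F P →
      ∫⁻ ω, (#(closePairs (π ω) P (4 * δ)) : ENNReal) ∂μ ≤ #P * ENNReal.ofReal (δ ^ (-M)) := by
  obtain ⟨c, hc, hπ⟩ := hπ.exists_lintegral_card_closePairs_le hm
  obtain ⟨M₁, hM₁, hM₁M⟩ := exists_between (max_lt hM (max_lt hsM htM))
  obtain ⟨M₂, hM₁₂, hM₂M⟩ := exists_between hM₁M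
  simp only [max_lt_iff] at hM₁
  obtain ⟨hM₁, hsM₁, htM₁⟩ := hM₁
  filter_upwards [eventually_isKatzTao hθ hs ht hF hm.le hM₁ hsM₁ htM₁,
    ht.eventually_card_le hθ hm.le hM₁ htM₁ hF, eventually_mul_rpow_neg_le hM₂M c,
    eventually_harmonic_le (add_nonneg hM₁.le hm.le) (sub_pos.mpr hM₁₂), self_mem_nhdsWithin]
    with δ hKT hcard hδM hharm hδ P hP
  replace hδ : 0 < δ := hδ
  have hharmP : (harmonic #P : ℝ) ≤ δ ^ (-(M₂ - M₁)) := by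
    refine hharm #P ((hcard P hP).trans_eq ?_)
    rw [one_div, Real.inv_rpow hδ.le, ← Real.rpow_neg hδ.le, ← Real.rpow_add hδ, neg_add]
  refine (hπ δ _ hδ P (hKT P hP)).trans ?_
  gcongr
  calc c * (δ ^ (-M₁) * (harmonic #P : ℝ)) ≤ c * (δ ^ (-M₁) * δ ^ (-(M₂ - M₁))) := by gcongr
    _ = c * δ ^ (-M₂) := by rw [← Real.rpow_add hδ]; congr 2; ring
    _ ≤ δ ^ (-M) := hδM

theorem IsTransversal.ae_eventually_coveringNumber_le (hπ : IsTransversal μ π m)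
    (hm : 0 < m) (hθ : 0 < θ) (hF : Bornology.IsBounded F) (hs : IsAssouadExponent F s)
    (ht : IsSpectrumExponent θ F t) (hM : 0 < M) (hsM : (s - m) * (1 - θ) < M) (htM : t - m < M) :
    ∀ᵐ ω ∂μ, ∀ᶠ k : ℕ in atTop, (coveringNumber (2 * (1 / 2) ^ k) F : ENNReal) ≤
      ENNReal.ofReal (((1 / 2 : ℝ) ^ k) ^ (-M)) * coveringNumber (4 * (1 / 2) ^ k) (π ω '' F) := by
  have hδ : ∀ k : ℕ, (0 : ℝ) < (1 / 2) ^ k := fun k => by positivity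
  have hδlim : Tendsto (fun k : ℕ => (1 / 2 : ℝ) ^ k) atTop (𝓝[>] 0) :=
    tendsto_nhdsWithin_iff.mpr ⟨tendsto_pow_atTop_nhds_zero_of_lt_one (by norm_num) (by norm_num),
      Eventually.of_forall hδ⟩
  have hfin : ∀ r : ℝ, 0 < r → coveringNumber r F ≠ ⊤ := fun r => hs.coveringNumber_ne_top hF
  choose P hP using fun k => exists_isNet (hδ k).le (hfin _ (hδ k))
  obtain ⟨M₁, hM₁, hM₁M⟩ := exists_between (max_lt hM (max_lt hsM htM))
  simp only [max_lt_iff] at hM₁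
  obtain ⟨hM₁, hsM₁, htM₁⟩ := hM₁
  have hmean : ∀ᶠ k in atTop, ∫⁻ ω, (#(closePairs (π ω) (P k) (4 * (1 / 2) ^ k)) : ENNReal) ∂μ ≤
      #(P k) * ENNReal.ofReal (((1 / 2 : ℝ) ^ k) ^ (-M)) *
        ENNReal.ofReal (((1 / 2 : ℝ) ^ (M - M₁)) ^ k) := by
    filter_upwards [hδlim.eventually (hπ.eventually_lintegral_card_closePairs_le hm hθ hs ht
      (hfin _ (by norm_num)) hM₁ hsM₁ htM₁)] with k hk
    refine (hk _ (hP k)).trans_eq ?_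
    rw [mul_assoc, ← ENNReal.ofReal_mul (by positivity), Real.rpow_pow_comm (by norm_num),
      ← Real.rpow_add (hδ k)]
    congr 3
    ring
  have hsum : ∑' k : ℕ, ENNReal.ofReal (((1 / 2 : ℝ) ^ (M - M₁)) ^ k) ≠ ⊤ :=
    (summable_geometric_of_lt_one (by positivity) (Real.rpow_lt_one (by norm_num) (by norm_num)
      (sub_pos.mpr hM₁M))).tsum_ofReal_ne_top
  filter_upwards [ae_eventually_le_of_lintegral_le
    (fun k => (hπ.measurable_card_closePairs (P k) _).aemeasurable)
    (fun k => ENNReal.mul_ne_top (ENNReal.natCast_ne_top _) ENNReal.ofReal_ne_top) hmean hsum]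
    with ω hω
  exact hω.mono fun k hk => (hP k).coveringNumber_le_of_card_closePairs_le (hδ k).le hk

end RandomImages

/-! ### Box dimensions of random images -/

section BoxDimensions

variable {X Y : Type*} [MetricSpace X] [MetricSpace Y] {E : Set X} {F : Set Y} {r M M' : ℝ}

theorem boxRatio_mono (hr : r ∈ Ioo (0 : ℝ) 1) (h : coveringNumber r E ≤ coveringNumber r F) :
    boxRatio E r ≤ boxRatio F r := by
  refine EReal.div_le_div_right_of_nonneg ?_ (ENNReal.log_monotone (by exact_mod_cast h))
  exact_mod_cast (neg_pos.mpr (Real.log_neg hr.1 hr.2)).le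

theorem upperBoxDim_le_of_coveringNumber_le
    (h : ∀ r, coveringNumber r E ≤ coveringNumber r F) : upperBoxDim E ≤ upperBoxDim F := by
  refine limsup_le_limsup ?_
  filter_upwards [Ioo_mem_nhdsGT one_pos] with r hr using boxRatio_mono hr (h r)

theorem upperBoxDim_mono {F : Set X} (h : E ⊆ F) : upperBoxDim E ≤ upperBoxDim F :=
  upperBoxDim_le_of_coveringNumber_le fun _ => coveringNumber_mono h

theorem boxRatio_le_add (hr : r ∈ Ioo (0 : ℝ) 1)
    (h : (coveringNumber r E : ENNReal) ≤ ENNReal.ofReal (r ^ (-M)) * coveringNumber r F) :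
    boxRatio E r ≤ (M : EReal) + boxRatio F r := by
  have hlog : 0 < -Real.log r := neg_pos.mpr (Real.log_neg hr.1 hr.2)
  have hlog' : (0 : EReal) < ((-Real.log r : ℝ) : EReal) := by exact_mod_cast hlog
  have hM : ENNReal.log (ENNReal.ofReal (r ^ (-M))) = ((M * -Real.log r : ℝ) : EReal) := by
    rw [ENNReal.log_ofReal_of_pos (Real.rpow_pos_of_pos hr.1 _), Real.log_rpow hr.1, neg_mul_comm]
  calc boxRatio E r
      ≤ (((M * -Real.log r : ℝ) : EReal) + ENNReal.log (coveringNumber r F : ENNReal)) /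
          ((-Real.log r : ℝ) : EReal) := by
        rw [← hM, ← ENNReal.log_mul_add]
        exact EReal.div_le_div_right_of_nonneg hlog'.le (ENNReal.log_monotone h)
    _ = ((M * -Real.log r : ℝ) : EReal) / ((-Real.log r : ℝ) : EReal) + boxRatio F r :=
        EReal.right_distrib_of_nonneg_of_ne_top (EReal.inv_nonneg_of_nonneg hlog'.le)
          (by rw [← EReal.coe_inv]; exact EReal.coe_ne_top _) _ _
    _ = M + boxRatio F r := by rw [← EReal.coe_div, mul_div_cancel_right₀ _ hlog.ne']

theorem upperBoxDim_le_add
    (h : ∀ᶠ r in 𝓝[>] (0 : ℝ), boxRatio E r ≤ (M : EReal) + boxRatio F r) :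
    upperBoxDim E ≤ M + upperBoxDim F := by
  have hM : limsup (fun _ : ℝ => (M : EReal)) (𝓝[>] 0) = M := limsup_const _
  have hadd := EReal.limsup_add_le (v := boxRatio F) (.inl (by rw [hM]; exact EReal.coe_ne_bot M))
    (.inl (by rw [hM]; exact EReal.coe_ne_top M))
  rw [hM] at hadd
  exact (limsup_le_limsup h).trans hadd

theorem lowerBoxDim_le_add
    (h : ∀ᶠ r in 𝓝[>] (0 : ℝ), boxRatio E r ≤ (M : EReal) + boxRatio F r) :
    lowerBoxDim E ≤ M + lowerBoxDim F := by
  have hM : limsup (fun _ : ℝ => (M : EReal)) (𝓝[>] 0) = M := limsup_const _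
  have hadd := EReal.liminf_add_le (v := boxRatio F) (.inl (by rw [hM]; exact EReal.coe_ne_bot M))
    (.inl (by rw [hM]; exact EReal.coe_ne_top M))
  rw [hM] at hadd
  exact (liminf_le_liminf h).trans hadd

theorem eventually_boxRatio_le_add (hM : 0 ≤ M) (hMM' : M < M')
    (h : ∀ᶠ k : ℕ in atTop, (coveringNumber (2 * (1 / 2) ^ k) E : ENNReal) ≤
      ENNReal.ofReal (((1 / 2 : ℝ) ^ k) ^ (-M)) * coveringNumber (4 * (1 / 2) ^ k) F) :
    ∀ᶠ r in 𝓝[>] (0 : ℝ), boxRatio E r ≤ (M' : EReal) + boxRatio F r := by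
  obtain ⟨k₀, hk₀⟩ := eventually_atTop.mp h
  filter_upwards [eventually_mul_rpow_neg_le hMM' (4 ^ M), Ioo_mem_nhdsGT one_pos,
    Ioo_mem_nhdsGT (show 0 < 2 * (1 / 2 : ℝ) ^ k₀ by positivity)] with r hr hr₁ hr₂
  obtain ⟨k, hk, hk'⟩ := exists_nat_pow_near_of_lt_one (x := r / 4) (y := (1 / 2 : ℝ))
    (by linarith [hr₁.1]) (by linarith [hr₁.2]) (by norm_num) (by norm_num)
  have hrk : 2 * (1 / 2) ^ k ≤ r := by rw [pow_succ] at hk; linarith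
  have hrk' : r ≤ 4 * (1 / 2) ^ k := by linarith
  have hkk₀ : k₀ ≤ k := by
    refine ((pow_lt_pow_iff_right_of_lt_one₀ (by norm_num) (by norm_num)).mp
      (show (1 / 2 : ℝ) ^ k < (1 / 2) ^ k₀ by linarith [hr₂.2])).le
  have hpow : ((1 / 2 : ℝ) ^ k) ^ (-M) ≤ r ^ (-M') :=
    calc ((1 / 2 : ℝ) ^ k) ^ (-M) ≤ (r / 4) ^ (-M) :=
          Real.rpow_le_rpow_of_nonpos (by linarith [hr₁.1]) hk' (neg_nonpos.mpr hM)
      _ = 4 ^ M * r ^ (-M) := by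
          rw [Real.div_rpow hr₁.1.le (by norm_num), Real.rpow_neg (by norm_num : (0 : ℝ) ≤ 4),
            div_inv_eq_mul, mul_comm]
      _ ≤ r ^ (-M') := hr
  refine boxRatio_le_add hr₁ ?_
  calc (coveringNumber r E : ENNReal) ≤ coveringNumber (2 * (1 / 2) ^ k) E :=
        ENat.toENNReal_mono (coveringNumber_anti hrk)
    _ ≤ ENNReal.ofReal (((1 / 2 : ℝ) ^ k) ^ (-M)) * coveringNumber (4 * (1 / 2) ^ k) F := hk₀ k hkk₀
    _ ≤ ENNReal.ofReal (r ^ (-M')) * coveringNumber r F :=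
        mul_le_mul' (ENNReal.ofReal_le_ofReal hpow)
          (ENat.toENNReal_mono (coveringNumber_anti hrk'))

end BoxDimensions

section DimensionDrop

variable {X : Type*} [MetricSpace X] {E F : Set X} {θ m q : ℝ}

/-- The bound for the loss of dimension under an `m`-dimensional random image, computed from the
upper Assouad spectrum at `θ` and the Assouad dimension. -/
noncomputable def dimensionDrop (m θ : ℝ) (F : Set X) : EReal :=
  max 0 (max (upperAssouadSpectrum θ F - (m : EReal))
    ((assouadDim F - (m : EReal)) * ((1 - θ : ℝ) : EReal)))

theorem dimensionDrop_mono (hθ : θ ≤ 1) (h : E ⊆ F) :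
    dimensionDrop m θ E ≤ dimensionDrop m θ F := by
  have hA : assouadDim E ≤ assouadDim F :=
    le_iInf₂ fun s hs => iInf₂_le s (IsAssouadExponent.mono hs h)
  have hS : upperAssouadSpectrum θ E ≤ upperAssouadSpectrum θ F :=
    le_iInf₂ fun t ht => iInf₂_le t (IsSpectrumExponent.mono ht h)
  refine max_le_max le_rfl (max_le_max (EReal.sub_le_sub hS le_rfl) ?_)
  exact mul_le_mul_of_nonneg_right (EReal.sub_le_sub hA le_rfl)
    (by exact_mod_cast sub_nonneg.mpr hθ)

theorem exists_isAssouadExponent_of_lt (hθ : θ < 1)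
    (h : (assouadDim F - (m : EReal)) * ((1 - θ : ℝ) : EReal) < (q : EReal)) :
    ∃ s, IsAssouadExponent F s ∧ (s - m) * (1 - θ) < q := by
  have hθ' : 0 < 1 - θ := sub_pos.mpr hθ
  rw [← EReal.lt_div_iff (by exact_mod_cast hθ') (EReal.coe_ne_top _), ← EReal.coe_div,
    EReal.sub_lt_iff (.inl (EReal.coe_ne_bot _)) (.inl (EReal.coe_ne_top _)), ← EReal.coe_add] at h
  obtain ⟨s, hs, hsq⟩ := by simpa only [assouadDim, iInf_lt_iff] using h
  exact ⟨s, hs, (lt_div_iff₀ hθ').mp (sub_lt_iff_lt_add.mpr (EReal.coe_lt_coe_iff.mp hsq))⟩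

theorem exists_isSpectrumExponent_of_lt
    (h : upperAssouadSpectrum θ F - (m : EReal) < (q : EReal)) :
    ∃ t, IsSpectrumExponent θ F t ∧ t - m < q := by
  rw [EReal.sub_lt_iff (.inl (EReal.coe_ne_bot _)) (.inl (EReal.coe_ne_top _)),
    ← EReal.coe_add] at h
  obtain ⟨t, ht, htq⟩ := by simpa only [upperAssouadSpectrum, iInf_lt_iff] using h
  exact ⟨t, ht, sub_lt_iff_lt_add.mpr (EReal.coe_lt_coe_iff.mp htq)⟩

theorem totallyBounded_of_dimensionDrop_ne_top (hθ : θ < 1) (hF : Bornology.IsBounded F)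
    (h : dimensionDrop m θ F ≠ ⊤) : TotallyBounded F := by
  obtain ⟨q, hq, -⟩ := EReal.lt_iff_exists_real_btwn.mp h.lt_top
  obtain ⟨s, hs, -⟩ := exists_isAssouadExponent_of_lt hθ
    ((le_max_right _ _).trans_lt ((le_max_right _ _).trans_lt hq))
  exact totallyBounded_of_coveringNumber_ne_top fun r hr => hs.coveringNumber_ne_top hF hr

theorem sub_le_of_forall_rat_lt {x y D : EReal}
    (h : ∀ q : ℚ, D < ((q : ℝ) : EReal) → x ≤ ((q : ℝ) : EReal) + y) : x - D ≤ y := by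
  by_contra! hlt
  obtain ⟨c, hyc, hc⟩ := EReal.lt_iff_exists_real_btwn.mp hlt
  have hD : D < x - c := EReal.lt_sub_iff_add_lt (.inl (EReal.coe_ne_bot _))
    (.inl (EReal.coe_ne_top _)) |>.mpr (by rw [add_comm]; exact EReal.add_lt_of_lt_sub hc)
  obtain ⟨q, hDq, hqx⟩ := EReal.lt_iff_exists_rat_btwn.mp hD
  refine (h q hDq).not_gt ((add_le_add le_rfl hyc.le).trans_lt (EReal.add_lt_of_lt_sub hqx))

end DimensionDrop

section RandomImages

variable {Ω X Y : Type*} [MeasurableSpace Ω] [MetricSpace X] [MetricSpace Y] {μ : Measure Ω}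
  [IsFiniteMeasure μ] {π : Ω → X → Y} {m θ : ℝ} {F : Set X}

theorem IsTransversal.ae_eventually_boxRatio_le (hπ : IsTransversal μ π m) (hm : 0 < m)
    (hθ₀ : 0 < θ) (hθ₁ : θ < 1) (hF : Bornology.IsBounded F) :
    ∀ᵐ ω ∂μ, ∀ q : ℚ, dimensionDrop m θ F < ((q : ℝ) : EReal) →
      ∀ᶠ r in 𝓝[>] (0 : ℝ), boxRatio F r ≤ ((q : ℝ) : EReal) + boxRatio (π ω '' F) r := by
  refine ae_all_iff.mpr fun q => eventually_imp_distrib_left.mpr fun hq => ?_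
  obtain ⟨M, hDM, hMq⟩ := EReal.exists_between_coe_real hq
  obtain ⟨hM, hSM, hAM⟩ := by simpa only [dimensionDrop, max_lt_iff] using hDM
  obtain ⟨s, hs, hsM⟩ := exists_isAssouadExponent_of_lt hθ₁ hAM
  obtain ⟨t, ht, htM⟩ := exists_isSpectrumExponent_of_lt hSM
  have hM₀ : 0 < M := EReal.coe_pos.mp hM
  filter_upwards [hπ.ae_eventually_coveringNumber_le hm hθ₀ hF hs ht hM₀ hsM htM] with ω hω
  exact eventually_boxRatio_le_add hM₀.le (EReal.coe_lt_coe_iff.mp hMq) hω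

theorem IsTransversal.ae_upperBoxDim_sub_le (hπ : IsTransversal μ π m) (hm : 0 < m)
    (hθ₀ : 0 < θ) (hθ₁ : θ < 1) (hF : Bornology.IsBounded F) :
    ∀ᵐ ω ∂μ, upperBoxDim F - dimensionDrop m θ F ≤ upperBoxDim (π ω '' F) := by
  filter_upwards [hπ.ae_eventually_boxRatio_le hm hθ₀ hθ₁ hF] with ω hω
  exact sub_le_of_forall_rat_lt fun q hq => upperBoxDim_le_add (hω q hq)

theorem IsTransversal.ae_lowerBoxDim_sub_le (hπ : IsTransversal μ π m) (hm : 0 < m)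
    (hθ₀ : 0 < θ) (hθ₁ : θ < 1) (hF : Bornology.IsBounded F) :
    ∀ᵐ ω ∂μ, lowerBoxDim F - dimensionDrop m θ F ≤ lowerBoxDim (π ω '' F) := by
  filter_upwards [hπ.ae_eventually_boxRatio_le hm hθ₀ hθ₁ hF] with ω hω
  exact sub_le_of_forall_rat_lt fun q hq => lowerBoxDim_le_add (hω q hq)

end RandomImages

/-! ### Packing dimension of random images -/

section PackingDim

variable {X : Type*} [MetricSpace X] {E F : Set X}

theorem packingDim_mono (h : E ⊆ F) : packingDim E ≤ packingDim F :=
  le_iInf₂ fun A hA => iInf₂_le A ⟨hA.1, h.trans hA.2⟩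

theorem coveringNumber_closure_le (r : ℝ) (E : Set X) :
    coveringNumber r (closure E) ≤ coveringNumber r E := by
  refine le_iInf₂ fun 𝒰 ⟨hdiam, hcover⟩ => ?_
  rcases 𝒰.finite_or_infinite with hfin | hinf
  · refine (iInf₂_le (closure '' 𝒰) ⟨?_, ?_⟩).trans (encard_image_le _ _)
    · rintro _ ⟨U, hU, rfl⟩
      exact (Metric.ediam_closure U).trans_le (hdiam U hU)
    · rw [sUnion_image, ← hfin.closure_sUnion]
      exact closure_mono hcover
  · exact hinf.encard_eq ▸ le_top

theorem packingDim_le_upperBoxDim [CompleteSpace X] (h : TotallyBounded E) :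
    packingDim E ≤ upperBoxDim E :=
  calc packingDim E ≤ ⨆ _ : ℕ, upperBoxDim (closure E) :=
        iInf₂_le (fun _ => closure E) ⟨fun _ => h.closure.isCompact_of_isClosed isClosed_closure,
          subset_closure.trans (subset_iUnion (fun _ : ℕ => closure E) 0)⟩
    _ ≤ upperBoxDim E := iSup_le fun _ =>
        upperBoxDim_le_of_coveringNumber_le fun r => coveringNumber_closure_le r E

theorem upperBoxDim_empty : upperBoxDim (∅ : Set X) = ⊥ := by
  have h : ∀ᶠ r in 𝓝[>] (0 : ℝ), boxRatio (∅ : Set X) r = ⊥ := by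
    filter_upwards [Ioo_mem_nhdsGT one_pos] with r hr
    have hlog : (0 : EReal) < ((-Real.log r : ℝ) : EReal) := by
      exact_mod_cast neg_pos.mpr (Real.log_neg hr.1 hr.2)
    rw [boxRatio, coveringNumber_empty, ENat.toENNReal_zero, ENNReal.log_zero,
      EReal.bot_div_of_pos_ne_top hlog (EReal.coe_ne_top _)]
  rw [upperBoxDim, limsup_congr h, limsup_const]

theorem packingDim_empty : packingDim (∅ : Set X) = ⊥ :=
  le_bot_iff.mp <| (iInf₂_le (fun _ => ∅) ⟨fun _ => isCompact_empty, empty_subset _⟩).trans <|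
    iSup_le fun _ => upperBoxDim_empty.le

theorem packingDim_iUnion_le {ι : Type*} [Countable ι] (E : ι → Set X) :
    packingDim (⋃ i, E i) ≤ ⨆ i, packingDim (E i) := by
  rcases isEmpty_or_nonempty ι with _ | _
  · rw [iUnion_of_empty, packingDim_empty]
    exact bot_le
  refine le_of_forall_gt_imp_ge_of_dense fun t ht => ?_
  have hE : ∀ i, ∃ A : ℕ → Set X, ((∀ j, IsCompact (A j)) ∧ E i ⊆ ⋃ j, A j) ∧
      ⨆ j, upperBoxDim (A j) < t := fun i => by
    simpa only [packingDim, iInf_lt_iff, exists_prop] using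
      (le_iSup (fun i => packingDim (E i)) i).trans_lt ht
  choose A hA hAt using hE
  obtain ⟨e, he⟩ := exists_surjective_nat (ι × ℕ)
  refine (iInf₂_le (fun k => A (e k).1 (e k).2) ⟨fun k => (hA _).1 _, ?_⟩).trans
    (iSup_le fun k => (le_iSup (fun j => upperBoxDim (A (e k).1 j)) _).trans (hAt _).le)
  rw [he.iUnion_comp fun p : ι × ℕ => A p.1 p.2, iUnion_prod']
  exact iUnion_mono fun i => (hA i).2

theorem packingDim_union_le (E F : Set X) :
    packingDim (E ∪ F) ≤ max (packingDim E) (packingDim F) := by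
  rw [union_eq_iUnion]
  exact (packingDim_iUnion_le _).trans_eq (iSup_bool_eq.trans rfl)

end PackingDim

section Condensation

variable {X Z : Type*} [MetricSpace X] [TopologicalSpace Z] {f : Z → X} {s : EReal}

/-- The points of `Z` all of whose neighbourhoods have an image under `f` of packing dimension
greater than `s`. -/
def condensation (f : Z → X) (s : EReal) : Set Z :=
  {z | ∀ U ∈ 𝓝 z, s < packingDim (f '' U)}

theorem isClosed_condensation : IsClosed (condensation f s) := by
  refine isOpen_compl_iff.mp (isOpen_iff_mem_nhds.mpr fun z hz => ?_)
  obtain ⟨U, hU, hUs⟩ : ∃ U ∈ 𝓝 z, ¬ s < packingDim (f '' U) := by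
    simpa only [condensation, mem_compl_iff, mem_ofPred_eq, not_forall, exists_prop] using hz
  filter_upwards [eventually_mem_nhds_iff.mpr hU] with w hw hws using hUs (hws U hw)

theorem packingDim_image_compl_condensation_le [SecondCountableTopology Z] :
    packingDim (f '' (condensation f s)ᶜ) ≤ s := by
  have hU : ∀ z ∈ (condensation f s)ᶜ, ∃ U ∈ 𝓝 z, packingDim (f '' U) ≤ s := fun z hz => by
    simpa only [condensation, mem_compl_iff, mem_ofPred_eq, not_forall, exists_prop, not_lt]
      using hz
  choose! U hUz hUs using hU
  obtain ⟨t, htC, htc, hcover⟩ := TopologicalSpace.countable_cover_nhdsWithin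
    fun z hz => mem_nhdsWithin_of_mem_nhds (hUz z hz)
  have : Countable t := htc.to_subtype
  calc packingDim (f '' (condensation f s)ᶜ) ≤ packingDim (⋃ z : t, f '' U z) := by
        rw [← image_iUnion, ← biUnion_eq_iUnion t fun z _ => U z]
        exact packingDim_mono (image_mono hcover)
    _ ≤ ⨆ z : t, packingDim (f '' U z) := packingDim_iUnion_le _
    _ ≤ s := iSup_le fun z => hUs z (htC z.2)

theorem lt_packingDim_image_inter_condensation [SecondCountableTopology Z] {U : Set Z}
    (h : s < packingDim (f '' U)) : s < packingDim (f '' (U ∩ condensation f s)) := by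
  have hU : f '' U ⊆ f '' (U ∩ condensation f s) ∪ f '' (condensation f s)ᶜ := by
    rw [← image_union]
    exact image_mono fun z hz => (em (z ∈ condensation f s)).imp (fun hc => ⟨hz, hc⟩) id
  have hmax := h.trans_le ((packingDim_mono hU).trans (packingDim_union_le _ _))
  exact (lt_max_iff.mp hmax).resolve_right packingDim_image_compl_condensation_le.not_gt

theorem nonempty_condensation [SecondCountableTopology Z] (h : s < packingDim (range f)) :
    (condensation f s).Nonempty := by
  rw [← image_univ] at h
  have hC := lt_packingDim_image_inter_condensation h
  rw [nonempty_iff_ne_empty]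
  intro hemp
  rw [hemp, inter_empty, image_empty, packingDim_empty] at hC
  exact not_lt_bot hC

end Condensation

section Packing

theorem exists_open_inter_subset_preimage {ι Y Z : Type*} [Countable ι] [TopologicalSpace Y]
    [TopologicalSpace Z] [PolishSpace Z] {C : Set Z} (hC : IsClosed C) (hne : C.Nonempty)
    {g : Z → Y} (hg : Continuous g) {A : ι → Set Y} (hA : ∀ j, IsClosed (A j))
    (hcover : g '' C ⊆ ⋃ j, A j) :
    ∃ j, ∃ O : Set Z, IsOpen O ∧ (O ∩ C).Nonempty ∧ O ∩ C ⊆ g ⁻¹' A j := by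
  have : PolishSpace C := hC.polishSpace
  have : Nonempty C := hne.to_subtype
  obtain ⟨j, z, hz⟩ := nonempty_interior_of_iUnion_of_closed
    (f := fun j => (fun z : C => g z) ⁻¹' A j)
    (fun j => (hA j).preimage (hg.comp continuous_subtype_val)) <| by
      rw [← preimage_iUnion, eq_univ_iff_forall]
      exact fun z => hcover (mem_image_of_mem g z.2)
  obtain ⟨_, hsub, ⟨O, hO, rfl⟩, hzO⟩ := mem_interior.mp hz
  exact ⟨j, O, hO, ⟨z, hzO, z.2⟩, fun w hw => @hsub ⟨w, hw.2⟩ hw.1⟩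

variable {X Y : Type*} [MetricSpace X] [MetricSpace Y] {F : Set X} {s : EReal}

theorem exists_countable_forall_iInf_upperBoxDim_le_packingDim [CompleteSpace X]
    (hF : AnalyticSet F) (hbdd : ∀ E ⊆ F, Bornology.IsBounded E → TotallyBounded E)
    (hs : s < packingDim F) :
    ∃ 𝓔 : Set (Set X), 𝓔.Countable ∧
      (∀ E ∈ 𝓔, E ⊆ F ∧ Bornology.IsBounded E ∧ s < upperBoxDim E) ∧
      ∀ g : X → Y, Continuous g → ⨅ E ∈ 𝓔, upperBoxDim (g '' E) ≤ packingDim (g '' F) := by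
  obtain ⟨Z, _, _, f, hf, rfl⟩ := analyticSet_iff_exists_polishSpace_range.mp hF
  set C := condensation f s
  -- If compact sets cover `g '' F`, then by Baire one of them contains the image of some
  -- `f '' (b ∩ C)` with `b` basic open.
  set ℬ := {b ∈ TopologicalSpace.countableBasis Z |
    (b ∩ C).Nonempty ∧ Bornology.IsBounded (f '' b)}
  refine ⟨(fun b => f '' (b ∩ C)) '' ℬ,
    ((TopologicalSpace.countable_countableBasis Z).mono (sep_subset _ _)).image _, ?_, ?_⟩
  · rintro _ ⟨b, ⟨hb, ⟨z, hzb, hzC⟩, hbd⟩, rfl⟩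
    have hbd' : Bornology.IsBounded (f '' (b ∩ C)) := hbd.subset (image_mono inter_subset_left)
    have hb_nhds : b ∈ 𝓝 z := (TopologicalSpace.isOpen_of_mem_countableBasis hb).mem_nhds hzb
    exact ⟨image_subset_range _ _, hbd',
      (lt_packingDim_image_inter_condensation (hzC b hb_nhds)).trans_le
        (packingDim_le_upperBoxDim (hbdd _ (image_subset_range _ _) hbd'))⟩
  · intro g hg
    refine le_iInf₂ fun A ⟨hA, hcover⟩ => ?_
    obtain ⟨j, O, hO, ⟨z, hzO, hzC⟩, hOA⟩ := exists_open_inter_subset_preimage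
      isClosed_condensation (nonempty_condensation hs) (hg.comp hf) (fun j => (hA j).isClosed) <| by
        rw [image_comp]
        exact (image_mono (image_subset_range f C)).trans hcover
    obtain ⟨b, hb, hzb, hbO⟩ :=
      (TopologicalSpace.isBasis_countableBasis Z).exists_subset_of_mem_open
        (show z ∈ O ∩ f ⁻¹' Metric.ball (f z) 1 from ⟨hzO, Metric.mem_ball_self one_pos⟩)
        (hO.inter (Metric.isOpen_ball.preimage hf))
    have hbℬ : b ∈ ℬ := ⟨hb, ⟨z, hzb, hzC⟩,
      Metric.isBounded_ball.subset (image_subset_iff.mpr (hbO.trans inter_subset_right))⟩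
    refine (iInf₂_le _ (mem_image_of_mem _ hbℬ)).trans
      ((upperBoxDim_mono ?_).trans (le_iSup (fun j => upperBoxDim (A j)) j))
    rw [← image_comp, image_subset_iff]
    exact fun w hw => hOA ⟨(hbO hw.1).1, hw.2⟩

theorem IsTransversal.ae_packingDim_sub_le {Ω : Type*} [MeasurableSpace Ω] [CompleteSpace X]
    {μ : Measure Ω} [IsFiniteMeasure μ] {π : Ω → X → Y} {m θ : ℝ} (hπ : IsTransversal μ π m)
    (hcont : ∀ ω, Continuous (π ω)) (hm : 0 < m) (hθ₀ : 0 < θ) (hθ₁ : θ < 1)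
    (hF : AnalyticSet F) :
    ∀ᵐ ω ∂μ, packingDim F - dimensionDrop m θ F ≤ packingDim (π ω '' F) := by
  rcases eq_or_ne (dimensionDrop m θ F) ⊤ with htop | htop
  · simp [htop]
  have hbot : dimensionDrop m θ F ≠ ⊥ := (EReal.bot_lt_zero.trans_le (le_max_left _ _)).ne'
  have hbdd : ∀ E ⊆ F, Bornology.IsBounded E → TotallyBounded E := fun E hE hb =>
    totallyBounded_of_dimensionDrop_ne_top hθ₁ hb
      (ne_top_of_le_ne_top htop (dimensionDrop_mono hθ₁.le hE))
  have hrat : ∀ᵐ ω ∂μ, ∀ q : ℚ, ((q : ℝ) : EReal) < packingDim F →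
      ((q : ℝ) : EReal) - dimensionDrop m θ F ≤ packingDim (π ω '' F) := by
    refine ae_all_iff.mpr fun q => eventually_imp_distrib_left.mpr fun hq => ?_
    obtain ⟨𝓔, h𝓔, hE, hinf⟩ :=
      exists_countable_forall_iInf_upperBoxDim_le_packingDim (Y := Y) hF hbdd hq
    have hbox : ∀ᵐ ω ∂μ, ∀ E ∈ 𝓔,
        upperBoxDim E - dimensionDrop m θ E ≤ upperBoxDim (π ω '' E) :=
      (ae_ball_iff h𝓔).mpr fun E hE𝓔 => hπ.ae_upperBoxDim_sub_le hm hθ₀ hθ₁ (hE E hE𝓔).2.1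
    filter_upwards [hbox] with ω hω
    refine (le_iInf₂ fun E hE𝓔 => ?_).trans (hinf (π ω) (hcont ω))
    obtain ⟨hEF, -, hqE⟩ := hE E hE𝓔
    exact (EReal.sub_le_sub hqE.le (dimensionDrop_mono hθ₁.le hEF)).trans (hω E hE𝓔)
  filter_upwards [hrat] with ω hω
  rw [EReal.sub_le_iff_le_add (.inl hbot) (.inl htop)]
  by_contra! hlt
  obtain ⟨q, hq, hqF⟩ := EReal.lt_iff_exists_rat_btwn.mp hlt
  exact hq.not_ge ((EReal.sub_le_iff_le_add (.inl hbot) (.inl htop)).mp (hω q hqF))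

end Packing

end ProjDim

theorem theorem1p1_general {Ω X Y : Type*} [MeasurableSpace Ω] [MetricSpace X] [CompleteSpace X]
    [MetricSpace Y] {μ : Measure Ω} [IsFiniteMeasure μ] {π : Ω → X → Y} {m θ : ℝ}
    (hπ : IsTransversal μ π m) (hcont : ∀ ω, Continuous (π ω)) (hm : 0 < m) (hθ₀ : 0 < θ)
    (hθ₁ : θ < 1) (F : Set X) :
    (Bornology.IsBounded F →
      (∀ᵐ ω ∂μ, upperBoxDim (π ω '' F) ≥ upperBoxDim F - dimensionDrop m θ F) ∧
      (∀ᵐ ω ∂μ, lowerBoxDim (π ω '' F) ≥ lowerBoxDim F - dimensionDrop m θ F)) ∧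
    (AnalyticSet F →
      ∀ᵐ ω ∂μ, packingDim (π ω '' F) ≥ packingDim F - dimensionDrop m θ F) :=
  ⟨fun hF => ⟨hπ.ae_upperBoxDim_sub_le hm hθ₀ hθ₁ hF, hπ.ae_lowerBoxDim_sub_le hm hθ₀ hθ₁ hF⟩,
    hπ.ae_packingDim_sub_le hcont hm hθ₀ hθ₁⟩

theorem theorem1p1 (n m : ℕ) (hm : 1 ≤ m) (hmn : m < n) (θ : ℝ) (hθ₀ : 0 < θ) (hθ₁ : θ < 1)
    (F : Set (EuclideanSpace ℝ (Fin n))) (hF : F.Nonempty) :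
    (Bornology.IsBounded F →
      (∀ᵐ V ∂(grassmannMeasure hmn.le),
        upperBoxDim (V.proj '' F) ≥ upperBoxDim F -
          max 0 (max (upperAssouadSpectrum θ F - (m : EReal))
            ((assouadDim F - (m : EReal)) * ((1 - θ : ℝ) : EReal)))) ∧
      (∀ᵐ V ∂(grassmannMeasure hmn.le),
        lowerBoxDim (V.proj '' F) ≥ lowerBoxDim F -
          max 0 (max (upperAssouadSpectrum θ F - (m : EReal))
            ((assouadDim F - (m : EReal)) * ((1 - θ : ℝ) : EReal))))) ∧
    (MeasurableSet F →
      ∀ᵐ V ∂(grassmannMeasure hmn.le),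
        packingDim (V.proj '' F) ≥ packingDim F -
          max 0 (max (upperAssouadSpectrum θ F - (m : EReal))
            ((assouadDim F - (m : EReal)) * ((1 - θ : ℝ) : EReal)))) := by
  have h := theorem1p1_general (isTransversal_proj hmn.le) (fun V => V.proj.continuous)
    (by exact_mod_cast hm) hθ₀ hθ₁ F
  exact ⟨h.1, fun hF => h.2 hF.analyticSet⟩
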